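/- Let $H$ be a complete nonarchimedean normed commutative ring. **Analytic algebras.** For a set $S$ with a weight $w:S\to\mathbb{R}_{>0}$ let $c_0(S,w;H)$ be the free Banach $H$-module of families $(x_s)_{s\in S}$ in $H$ with $\|x_s\|w(s)\to 0$, normed by $\sup_s\|x_s\|w(s)$; write $P\otimes Q=c_0(S\times T,wv;H)$ for $P=c_0(S,w;H)$, $Q=c_0(T,v;H)$. These modules are compact projective generators of the quasi-abelian category of ind-Banach $H$-modules, whose left heart (the same for monomorphic and for arbitrary ind-objects) is the category of additive presheaves of abelian groups on the category of the modules $c_0(S,w;H)$ and bounded $H$-linear maps; the tensor product of free modules extends to it. An *analytic algebra* is a commutative algebra in this left heart. Let $\mathrm{sAlg}_H$ be the category of simplicial analytic algebras. For $R\in \mathrm{sAlg}_H$ the homotopy objects $\pi_n(R)$ are computed in the left heart, i.e. $\pi_n(R)(P)=\pi_n(R(P))$ for $P$ free; $\pi_0(R)$ is an analytic algebra and $\pi_n(R)$ is a $\pi_0(R)$-module. Inverting the morphisms that induce isomorphisms on all $\pi_n$ one obtains the $\infty$-category of simplicial commutative ind-Banach $H$-algebras, $\mathrm{sComm}(\mathrm{Simp}\,\mathrm{Ind}(\mathrm{Ban}_H))$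 or $\mathrm{sComm}(\mathrm{Simp}\,\mathrm{Ind}^m(\mathrm{Ban}_H))$. For an object $B$ let $X=\mathrm{Spec}\,B$ be the functor $X(R)=\mathrm{Map}(B,R)$, the mapping space in this $\infty$-category. **Relative crystalline functor.** Let $f:A\to B$ be a morphism in $\mathrm{sAlg}_H$, $X=\mathrm{Spec}\,B\to Y=\mathrm{Spec}\,A$. For $R\in\mathrm{sAlg}_H$ put $$Y_{X,\mathrm{crys}}(R)=\varinjlim_{(I,\gamma)}X(\pi_0(R)/I)\times_{Y(\pi_0(R)/I)}Y(R)$$ (homotopy fibre products), where $(I,\gamma)$ runs over the nilpotent ideals $I$ of the analytic algebra $\pi_0(R)$ together with a divided power structure $\gamma$ on the ideal $I(H)$ of the underlying ring $\pi_0(R)(H)$, ordered by inclusions compatible with the divided powers, and $\pi_0(R)/I$ is viewed as a constant simplicial analytic algebra. There is a canonical map $X(R)\to Y_{X,\mathrm{crys}}(R)$. **PD intrinsic étale morphisms.** The morphism $f$ (or $X\to Y$) is *affinoid* if 1. for some $d\ge 0$ the map $\pi_0(A)\to\pi_0(B)$ extends to an epimorphism $\pi_0(A)\langle X_1,\dots,X_d\rangle\to\pi_0(B)$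 of analytic algebras, where $\pi_0(A)\langle X_1,\dots,X_d\rangle=\pi_0(A)\otimes H\langle X_1,\dots,X_d\rangle$; and 2. $\pi_0(B)\otimes_{\pi_0(A)}\pi_n(A)\to\pi_n(B)$ is an isomorphism for every $n\ge0$. It is *PD intrinsic étale* if it is affinoid and the canonical map $\pi_0(X(R))\to\pi_0(Y_{X,\mathrm{crys}}(R))$ is bijective for every $R\in\mathrm{sAlg}_H$. **Proposition.** Compositions of PD intrinsic étale morphisms are PD intrinsic étale: if $f:A\to B$ and $g:B\to C$ are morphisms in $\mathrm{sAlg}_H$ such that $\mathrm{Spec}\,B\to\mathrm{Spec}\,A$ and $\mathrm{Spec}\,C\to\mathrm{Spec}\,B$ are PD intrinsic étale, then $\mathrm{Spec}\,C\to\mathrm{Spec}\,A$, given by $g\circ f$, is PD intrinsic étale. -/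

import Mathlib

open CategoryTheory Opposite Filter Topology Simplicial

universe u

noncomputable section

namespace AnGeom

section FreeModules

/-- A normed set `(S, w)`: a set with a weight `w s > 0` for every element.  It stands for the free
Banach `H`-module `c₀(S, w; H)` on it; these are the projective generators of Banach `H`-modules. -/
structure Fr (H : Type u) : Type (u + 1) where
  carrier : Type u
  wt : carrier → ℝ
  wt_pos : ∀ s, 0 < wt s

variable {H : Type u} [NormedCommRing H]

/-- The module `c₀(S, w; H)` of families `x : S → H` with `‖x s‖ * w s → 0`; its norm is
`sup_s ‖x s‖ * w s`. -/
def C0 (P : Fr H) : Submodule H (P.carrier → H) where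
  carrier := {x | Tendsto (fun s => ‖x s‖ * P.wt s) cofinite (𝓝 0)}
  zero_mem' := by simpa using! tendsto_const_nhds
  add_mem' := by
    intro x y hx hy
    refine squeeze_zero (fun s => mul_nonneg (norm_nonneg _) (P.wt_pos s).le) (fun s => ?_)
      (by simpa using Tendsto.add hx hy)
    rw [← add_mul]
    exact mul_le_mul_of_nonneg_right (norm_add_le _ _) (P.wt_pos s).le
  smul_mem' := by
    intro c x hx
    refine squeeze_zero (fun s => mul_nonneg (norm_nonneg _) (P.wt_pos s).le) (fun s => ?_)
      (by simpa using Tendsto.const_mul ‖c‖ hx)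
    rw [← mul_assoc]
    exact mul_le_mul_of_nonneg_right (norm_mul_le _ _) (P.wt_pos s).le

/-- `‖x‖ ≤ r` in `c₀(S, w; H)`. -/
def NormLE {P : Fr H} (x : C0 P) (r : ℝ) : Prop := ∀ s, ‖x.1 s‖ * P.wt s ≤ r

/-- The bounded `H`-linear maps `c₀(P) → c₀(Q)`. -/
def BddHom (P Q : Fr H) : Submodule H (C0 P →ₗ[H] C0 Q) where
  carrier := {f | ∃ C : ℝ, 0 ≤ C ∧ ∀ (x : C0 P) (r : ℝ), 0 ≤ r → NormLE x r → NormLE (f x) (C * r)}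
  zero_mem' := ⟨0, le_rfl, fun x r _ _ _ => by simp⟩
  add_mem' := by
    rintro f g ⟨C, hC, hf⟩ ⟨D, hD, hg⟩
    refine ⟨C + D, add_nonneg hC hD, fun x r hr hx s => ?_⟩
    have h1 := hf x r hr hx s
    have h2 := hg x r hr hx s
    calc ‖(f x).1 s + (g x).1 s‖ * Q.wt s ≤ (‖(f x).1 s‖ + ‖(g x).1 s‖) * Q.wt s :=
          mul_le_mul_of_nonneg_right (norm_add_le _ _) (Q.wt_pos s).le
      _ ≤ (C + D) * r := by rw [add_mul, add_mul]; exact add_le_add h1 h2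
  smul_mem' := by
    rintro c f ⟨C, hC, hf⟩
    refine ⟨‖c‖ * C, mul_nonneg (norm_nonneg _) hC, fun x r hr hx s => ?_⟩
    have h1 := hf x r hr hx s
    calc ‖c * (f x).1 s‖ * Q.wt s ≤ (‖c‖ * ‖(f x).1 s‖) * Q.wt s :=
          mul_le_mul_of_nonneg_right (norm_mul_le _ _) (Q.wt_pos s).le
      _ ≤ ‖c‖ * C * r := by
          rw [mul_assoc, mul_assoc]; exact mul_le_mul_of_nonneg_left h1 (norm_nonneg _)

/-- The category of free Banach `H`-modules `c₀(S, w; H)` and bounded `H`-linear maps. -/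
instance : Category (Fr H) where
  Hom P Q := BddHom P Q
  id P := ⟨LinearMap.id, 1, zero_le_one, fun x r _ hx => by simpa using hx⟩
  comp f g := ⟨g.1.comp f.1, by
    obtain ⟨C, hC, hf⟩ := f.2
    obtain ⟨D, hD, hg⟩ := g.2
    refine ⟨D * C, mul_nonneg hD hC, fun x r hr hx => ?_⟩
    rw [mul_assoc]
    exact hg _ _ (mul_nonneg hC hr) (hf x r hr hx)⟩

instance (P Q : Fr H) : AddCommGroup (P ⟶ Q) :=
  Submodule.addCommGroup (R := H) (M := C0 P →ₗ[H] C0 Q) (BddHom P Q)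

/-- The value of a morphism at an element. -/
def ev {P Q : Fr H} (f : P ⟶ Q) : C0 P →ₗ[H] C0 Q := f.1

theorem hom_ext {P Q : Fr H} {f g : P ⟶ Q} (h : ∀ x s, (ev f x).1 s = (ev g x).1 s) : f = g :=
  Subtype.ext (LinearMap.ext fun x => Subtype.ext (funext (h x)))

@[simp] theorem ev_comp {P Q R : Fr H} (f : P ⟶ Q) (g : Q ⟶ R) (x : C0 P) :
    ev (f ≫ g) x = ev g (ev f x) := rfl

/-- The tensor product `c₀(S, w) ⊗ c₀(T, v) = c₀(S × T, w v)` (completed, over `H`). -/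
def Fr.tensor (P Q : Fr H) : Fr H where
  carrier := P.carrier × Q.carrier
  wt s := P.wt s.1 * Q.wt s.2
  wt_pos _ := mul_pos (P.wt_pos _) (Q.wt_pos _)

/-- The unit `c₀(pt, 1) = H`. -/
def Fr.pt : Fr H where
  carrier := PUnit
  wt _ := 1
  wt_pos _ := zero_lt_one

/-- The isomorphism `c₀(P) → c₀(Q)` given by a weight preserving bijection of index sets. -/
def reindex {P Q : Fr H} (e : P.carrier ≃ Q.carrier) (he : ∀ s, Q.wt (e s) = P.wt s) : P ⟶ Q :=
  ⟨{ toFun := fun x => ⟨fun t => x.1 (e.symm t), by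
        have := (x.2 : Tendsto _ _ _).comp e.symm.injective.tendsto_cofinite
        refine this.congr fun t => ?_
        simp [← he]⟩
     map_add' := fun _ _ => rfl
     map_smul' := fun _ _ => rfl },
   1, zero_le_one, fun x r _ hx t => by
      have := hx (e.symm t)
      rw [← he] at this
      simpa using this⟩

def swap (P Q : Fr H) : P.tensor Q ⟶ Q.tensor P :=
  reindex (Equiv.prodComm P.carrier Q.carrier) fun _ => mul_comm _ _

def assoc (P Q R : Fr H) : (P.tensor Q).tensor R ⟶ P.tensor (Q.tensor R) :=
  reindex (Equiv.prodAssoc P.carrier Q.carrier R.carrier) fun _ => (mul_assoc _ _ _).symm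

def leftUnit (P : Fr H) : Fr.pt.tensor P ⟶ P :=
  reindex (Equiv.punitProd P.carrier) fun _ => (one_mul _).symm

/-- The isomorphism `H = H ⊗ H`. -/
def dup : (Fr.pt : Fr H) ⟶ Fr.pt.tensor Fr.pt :=
  reindex (Equiv.punitProd PUnit).symm fun _ => one_mul _

/-- The slice `z(·, t)` of an element of `c₀(S × T)`. -/
def slice {P Q : Fr H} (z : C0 (P.tensor Q)) (t : Q.carrier) : C0 P :=
  ⟨fun s => z.1 (s, t), by
    have h1 : Tendsto (fun s : P.carrier => ‖z.1 (s, t)‖ * (P.wt s * Q.wt t)) cofinite (𝓝 0) :=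
      (z.2 : Tendsto _ _ _).comp (Prod.mk_left_injective t).tendsto_cofinite
    have h2 := h1.mul_const (Q.wt t)⁻¹
    rw [zero_mul] at h2
    refine h2.congr fun s => ?_
    have := (Q.wt_pos t).ne'
    field_simp⟩

/-- `f ⊗ id : c₀(P) ⊗ c₀(Q) → c₀(P') ⊗ c₀(Q)`, i.e. `f` applied slice by slice. -/
def rTensor {P P' : Fr H} (f : P ⟶ P') (Q : Fr H) : P.tensor Q ⟶ P'.tensor Q :=
  ⟨{ toFun := fun z => ⟨fun s => (ev f (slice z s.2)).1 s.1, by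
        obtain ⟨C, hC, hf⟩ := f.2
        have hz : Tendsto (fun s => ‖z.1 s‖ * (P.tensor Q).wt s) cofinite (𝓝 0) := z.2
        change Tendsto (fun s : P'.carrier × Q.carrier =>
          ‖(ev f (slice z s.2)).1 s.1‖ * (P'.wt s.1 * Q.wt s.2)) cofinite (𝓝 0)
        rw [Metric.tendsto_nhds] at hz ⊢
        intro ε hε
        have hC1 : 0 < C + 1 := by linarith
        have hfin := hz (ε / (2 * (C + 1))) (by positivity)
        rw [eventually_cofinite] at hfin ⊢
        refine ((hfin.image Prod.snd).biUnion (t := fun t => Set.image (fun s => (s, t))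
          (Set.ofPred fun s : P'.carrier => ¬ (‖(ev f (slice z t)).1 s‖ * P'.wt s < ε / Q.wt t)))
          ?_).subset ?_
        · intro t _
          refine Set.Finite.image _ ?_
          have h2 : Tendsto (fun s => ‖(ev f (slice z t)).1 s‖ * P'.wt s) cofinite (𝓝 0) :=
            (ev f (slice z t)).2
          exact eventually_cofinite.1
            (h2.eventually (gt_mem_nhds (div_pos hε (Q.wt_pos t))))
        · rintro ⟨s, t⟩ hst
          have hst : ¬ ‖(ev f (slice z t)).1 s‖ * (P'.wt s * Q.wt t) < ε := by
            intro h
            apply hst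
            rw [Real.dist_0_eq_abs, abs_of_nonneg]
            · exact h
            · exact mul_nonneg (norm_nonneg _) (mul_pos (P'.wt_pos _) (Q.wt_pos _)).le
          refine Set.mem_biUnion (x := t) ?_ ⟨s, ?_, rfl⟩
          · by_contra hcon
            apply hst
            have hle : NormLE (slice z t) (ε / (2 * (C + 1)) / Q.wt t) := by
              intro s'
              by_contra h'
              apply hcon
              refine ⟨(s', t), fun h'' => h' ?_, rfl⟩
              rw [Real.dist_0_eq_abs] at h''
              have h3 := (le_abs_self _).trans h''.le
              rw [le_div_iff₀ (Q.wt_pos t), mul_assoc]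
              exact h3
            have h4 := hf _ _ (by have := Q.wt_pos t; positivity) hle s
            have h5 := mul_le_mul_of_nonneg_right h4 (Q.wt_pos t).le
            rw [mul_assoc] at h5
            refine lt_of_le_of_lt h5 ?_
            have := Q.wt_pos t
            field_simp
            nlinarith
          · intro h
            apply hst
            rw [lt_div_iff₀ (Q.wt_pos t), mul_assoc] at h
            exact h⟩
     map_add' := fun x y => Subtype.ext (funext fun s =>
        congrArg (fun v : C0 P' => v.1 s.1) ((ev f).map_add (slice x s.2) (slice y s.2)))
     map_smul' := fun c x => Subtype.ext (funext fun s =>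
        congrArg (fun v : C0 P' => v.1 s.1) ((ev f).map_smul c (slice x s.2))) }, by
    obtain ⟨C, hC, hf⟩ := f.2
    refine ⟨C, hC, fun z r hr hz s => ?_⟩
    have hle : NormLE (slice z s.2) (r / Q.wt s.2) := by
      intro s'
      rw [le_div_iff₀ (Q.wt_pos _), mul_assoc]
      exact hz (s', s.2)
    have h4 := hf _ _ (div_nonneg hr (Q.wt_pos _).le) hle s.1
    have h5 := mul_le_mul_of_nonneg_right h4 (Q.wt_pos s.2).le
    rw [mul_assoc, mul_assoc, div_mul_cancel₀ _ (Q.wt_pos s.2).ne'] at h5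
    exact h5⟩

/-- The free module `c₀(ℕᵈ, 1)`, underlying the Tate algebra `H⟨X₁, …, X_d⟩`. -/
def tate (d : ℕ) : Fr H where
  carrier := ULift.{u} (Fin d →₀ ℕ)
  wt _ := 1
  wt_pos _ := zero_lt_one

/-- The unit `H → H⟨X₁, …, X_d⟩`, sending `1` to the monomial `X^0`. -/
def tateOne (d : ℕ) : (Fr.pt : Fr H) ⟶ tate d :=
  ⟨{ toFun := fun x => ⟨fun ν => if ν.down = 0 then x.1 PUnit.unit else 0, by
        refine tendsto_nhds_of_eventually_eq ?_
        rw [eventually_cofinite]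
        refine (Set.finite_singleton (ULift.up (0 : Fin d →₀ ℕ))).subset fun ν hν => ?_
        by_contra h
        apply hν
        have : ν.down ≠ 0 := fun h0 => h (ULift.ext _ _ h0)
        simp [this]⟩
     map_add' := fun x y => Subtype.ext (funext fun ν => by
        by_cases h : ν.down = 0 <;> simp [h]
        all_goals rfl)
     map_smul' := fun c x => Subtype.ext (funext fun ν => by
        by_cases h : ν.down = 0 <;> simp [h]
        all_goals rfl) },
   1, zero_le_one, fun x r hr hx ν => by
      have := hx PUnit.unit
      change ‖if ν.down = 0 then x.1 PUnit.unit else 0‖ * 1 ≤ 1 * r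
      by_cases h : ν.down = 0
      · simpa [h, Fr.pt] using this
      · simpa [h] using hr⟩

/-- The multiplication of `H⟨X₁, …, X_d⟩`, sending `X^μ ⊗ X^ν` to `X^(μ + ν)`. -/
def tateMul [IsUltrametricDist H] (d : ℕ) : (tate d : Fr H).tensor (tate d) ⟶ tate d :=
  ⟨{ toFun := fun z => ⟨fun κ => ∑ p ∈ Finset.HasAntidiagonal.antidiagonal κ.down, z.1 (⟨p.1⟩, ⟨p.2⟩), by
        have hz : Tendsto (fun s => ‖z.1 s‖ * ((tate d : Fr H).tensor (tate d)).wt s)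
          cofinite (𝓝 0) := z.2
        change Tendsto (fun κ : ULift.{u} (Fin d →₀ ℕ) =>
          ‖∑ p ∈ Finset.HasAntidiagonal.antidiagonal κ.down, z.1 (⟨p.1⟩, ⟨p.2⟩)‖ * 1) cofinite (𝓝 0)
        rw [Metric.tendsto_nhds] at hz ⊢
        intro ε hε
        have hfin := hz (ε / 2) (half_pos hε)
        rw [eventually_cofinite] at hfin ⊢
        refine (hfin.image (fun s => (ULift.up (s.1.down + s.2.down)))).subset ?_
        intro κ hκ
        by_contra hcon
        apply hκ
        rw [Real.dist_0_eq_abs, mul_one, abs_norm]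
        refine lt_of_le_of_lt ?_ (half_lt_self hε)
        refine IsUltrametricDist.norm_sum_le_of_forall_le_of_nonneg (half_pos hε).le ?_
        intro p hp
        by_contra h'
        apply hcon
        refine ⟨(⟨p.1⟩, ⟨p.2⟩), fun h'' => h' ?_, ?_⟩
        · rw [Real.dist_0_eq_abs] at h''
          have h3 := (le_abs_self _).trans h''.le
          simpa [Fr.tensor, tate] using h3
        · exact ULift.ext _ _ (Finset.HasAntidiagonal.mem_antidiagonal.1 hp)⟩
     map_add' := fun x y => Subtype.ext (funext fun _ =>
        Finset.sum_add_distrib)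
     map_smul' := fun c x => Subtype.ext (funext fun _ =>
        (Finset.mul_sum _ _ _).symm) },
   1, zero_le_one, fun x r hr hx κ => by
      change ‖∑ p ∈ Finset.HasAntidiagonal.antidiagonal κ.down, x.1 (⟨p.1⟩, ⟨p.2⟩)‖ * 1 ≤ 1 * r
      rw [mul_one, one_mul]
      refine IsUltrametricDist.norm_sum_le_of_forall_le_of_nonneg hr fun p _ => ?_
      simpa [Fr.tensor, tate] using hx (⟨p.1⟩, ⟨p.2⟩)⟩

/-- `id ⊗ g`. -/
def lTensor (P : Fr H) {Q Q' : Fr H} (g : Q ⟶ Q') : P.tensor Q ⟶ P.tensor Q' :=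
  swap P Q ≫ rTensor g P ≫ swap Q' P

end FreeModules

section AnalyticAlgebras

variable (H : Type u) [NormedCommRing H]

/-- An object of the left heart of the quasi-abelian category of ind-Banach `H`-modules (monomorphic
or not): an additive presheaf of abelian groups on the category of free Banach modules.  An
ind-Banach module `V` is the presheaf `P ↦ Hom(P, V)` of its bounded families; `H` acts through
its action on each `P`. -/
structure AnMod : Type (u + 2) where
  obj : Fr H → Type (u + 1)
  [grp : ∀ P, AddCommGroup (obj P)]
  map : ∀ {P Q : Fr H}, (P ⟶ Q) → obj Q →+ obj P
  map_id : ∀ {P : Fr H} (x : obj P), map (𝟙 P) x = x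
  map_comp : ∀ {P Q R : Fr H} (f : P ⟶ Q) (g : Q ⟶ R) (x : obj R),
    map (f ≫ g) x = map f (map g x)
  map_add : ∀ {P Q : Fr H} (f g : P ⟶ Q) (x : obj Q), map (f + g) x = map f x + map g x

attribute [instance] AnMod.grp

/-- A commutative algebra in the left heart of ind-Banach `H`-modules, for the tensor product that
extends the one of free Banach modules: a multiplication `A(P) × A(Q) → A(P ⊗ Q)`, biadditive,
natural, commutative, associative and unital. -/
structure AnAlg extends AnMod H where
  mul : ∀ {P Q : Fr H}, obj P →+ obj Q →+ obj (P.tensor Q)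
  one : obj Fr.pt
  mul_map : ∀ {P P' Q : Fr H} (f : P ⟶ P') (a : obj P') (b : obj Q),
    mul (map f a) b = map (rTensor f Q) (mul a b)
  mul_comm : ∀ {P Q : Fr H} (a : obj P) (b : obj Q), mul a b = map (swap P Q) (mul b a)
  mul_assoc : ∀ {P Q R : Fr H} (a : obj P) (b : obj Q) (c : obj R),
    mul (mul a b) c = map (assoc P Q R) (mul a (mul b c))
  one_mul : ∀ {P : Fr H} (a : obj P), mul one a = map (leftUnit P) a

variable {H}

/-- Morphisms of analytic commutative `H`-algebras. -/
@[ext] structure AnAlg.Hom (A B : AnAlg H) : Type (u + 1) where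
  app : ∀ P, A.obj P →+ B.obj P
  naturality : ∀ {P Q : Fr H} (f : P ⟶ Q) (x : A.obj Q), app P (A.map f x) = B.map f (app Q x)
  map_mul : ∀ {P Q : Fr H} (a : A.obj P) (b : A.obj Q),
    app (P.tensor Q) (A.mul a b) = B.mul (app P a) (app Q b)
  map_one : app Fr.pt A.one = B.one

instance : Category (AnAlg H) where
  Hom := AnAlg.Hom
  id A := ⟨fun P => AddMonoidHom.id _, fun _ _ => rfl, fun _ _ => rfl, rfl⟩
  comp f g := ⟨fun P => (g.app P).comp (f.app P),
    fun h x => by simp [f.naturality, g.naturality],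
    fun a b => by simp [f.map_mul, g.map_mul], by simp [f.map_one, g.map_one]⟩

/-- The value of a morphism of algebras on `P`-families. -/
def AnAlg.app {A B : AnAlg H} (f : A ⟶ B) (P : Fr H) : A.obj P →+ B.obj P := AnAlg.Hom.app f P

theorem AnAlg.hom_ext {A B : AnAlg H} {f g : A ⟶ B} (h : ∀ P x, app f P x = app g P x) : f = g :=
  AnAlg.Hom.ext (funext fun P => AddMonoidHom.ext (h P))

@[simp] theorem AnAlg.app_comp {A B C : AnAlg H} (f : A ⟶ B) (g : B ⟶ C) (P : Fr H)
    (x : A.obj P) : app (f ≫ g) P x = app g P (app f P x) := rfl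

@[simp] theorem AnAlg.app_id {A : AnAlg H} (P : Fr H) (x : A.obj P) : app (𝟙 A) P x = x := rfl

theorem AnAlg.app_map {A B : AnAlg H} (f : A ⟶ B) {P Q : Fr H} (g : P ⟶ Q) (x : A.obj Q) :
    app f P (A.map g x) = B.map g (app f Q x) := AnAlg.Hom.naturality f g x

theorem AnAlg.app_mul {A B : AnAlg H} (f : A ⟶ B) {P Q : Fr H} (a : A.obj P) (b : A.obj Q) :
    app f (P.tensor Q) (A.mul a b) = B.mul (app f P a) (app f Q b) := AnAlg.Hom.map_mul f a b

theorem AnAlg.mul_map_right (A : AnAlg H) {P Q Q' : Fr H} (g : Q ⟶ Q') (a : A.obj P)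
    (b : A.obj Q') : A.mul a (A.map g b) = A.map (lTensor P g) (A.mul a b) := by
  rw [A.mul_comm, A.mul_map, A.mul_comm b a, lTensor, A.map_comp, A.map_comp]

/-- The underlying commutative ring `A(pt)` of an analytic algebra. -/
def AnAlg.Pt (A : AnAlg H) : Type (u + 1) := A.obj Fr.pt

instance (A : AnAlg H) : AddCommGroup A.Pt := A.grp Fr.pt

/-- The product of the underlying ring. -/
def AnAlg.ptMul (A : AnAlg H) (a b : A.obj Fr.pt) : A.obj Fr.pt := A.map dup (A.mul a b)

theorem AnAlg.ptMul_comm (A : AnAlg H) (a b : A.obj Fr.pt) : A.ptMul a b = A.ptMul b a := by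
  unfold AnAlg.ptMul
  rw [A.mul_comm, ← A.map_comp]
  rfl

theorem AnAlg.ptMul_add (A : AnAlg H) (a b c : A.obj Fr.pt) :
    A.ptMul a (b + c) = A.ptMul a b + A.ptMul a c := by
  unfold AnAlg.ptMul
  rw [map_add, map_add]

theorem AnAlg.one_ptMul (A : AnAlg H) (a : A.obj Fr.pt) : A.ptMul A.one a = a := by
  unfold AnAlg.ptMul
  rw [A.one_mul, ← A.map_comp]
  exact A.map_id a

theorem AnAlg.ptMul_assoc (A : AnAlg H) (a b c : A.obj Fr.pt) :
    A.ptMul (A.ptMul a b) c = A.ptMul a (A.ptMul b c) := by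
  unfold AnAlg.ptMul
  rw [A.mul_map, A.mul_assoc, A.mul_map_right, ← A.map_comp, ← A.map_comp, ← A.map_comp]
  rfl

theorem AnAlg.zero_ptMul (A : AnAlg H) (a : A.obj Fr.pt) : A.ptMul 0 a = 0 := by
  simp [AnAlg.ptMul]

theorem AnAlg.ptMul_zero (A : AnAlg H) (a : A.obj Fr.pt) : A.ptMul a 0 = 0 := by
  simp [AnAlg.ptMul]

instance (A : AnAlg H) : CommRing A.Pt :=
  { (inferInstance : AddCommGroup A.Pt) with
    mul := A.ptMul
    one := A.one
    mul_assoc := A.ptMul_assoc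
    mul_comm := A.ptMul_comm
    one_mul := A.one_ptMul
    mul_one := fun a => (A.ptMul_comm a A.one).trans (A.one_ptMul a)
    left_distrib := A.ptMul_add
    right_distrib := fun a b c =>
      (A.ptMul_comm (a + b) c).trans ((A.ptMul_add c a b).trans
        (congrArg₂ (· + ·) (A.ptMul_comm c a) (A.ptMul_comm c b)))
    zero_mul := A.zero_ptMul
    mul_zero := A.ptMul_zero }

/-- An ideal of an analytic algebra `A`: an `A`-submodule of `A` in the left heart. -/
@[ext] structure AnIdeal (A : AnAlg H) where
  carrier : ∀ P, AddSubgroup (A.obj P)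
  map_mem : ∀ {P Q : Fr H} (f : P ⟶ Q) {x : A.obj Q}, x ∈ carrier Q → A.map f x ∈ carrier P
  mul_mem : ∀ {P Q : Fr H} (a : A.obj P) {x : A.obj Q}, x ∈ carrier Q →
    A.mul a x ∈ carrier (P.tensor Q)

namespace AnIdeal

variable {A : AnAlg H} (I : AnIdeal A)

theorem mul_mem' {P Q : Fr H} {x : A.obj P} (hx : x ∈ I.carrier P) (a : A.obj Q) :
    A.mul x a ∈ I.carrier (P.tensor Q) := by
  rw [A.mul_comm]
  exact I.map_mem _ (I.mul_mem a hx)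

/-- The ideal of the underlying ring. -/
def pt : Ideal A.Pt where
  carrier := {x | x ∈ I.carrier Fr.pt}
  add_mem' := (I.carrier Fr.pt).add_mem
  zero_mem' := (I.carrier Fr.pt).zero_mem
  smul_mem' := fun a _ hx => I.map_mem dup (I.mul_mem a hx)

/-- The families annihilated by all products of `n` families in `I`. -/
def annPow (I : AnIdeal A) (n : ℕ) : (P : Fr H) → Set (A.obj P) :=
  match n with
  | 0 => fun _ => {0}
  | n + 1 => fun P => {a | ∀ (Q : Fr H), ∀ x ∈ I.carrier Q, A.mul a x ∈ I.annPow n (P.tensor Q)}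

/-- `I` is nilpotent: `I ^ n = 0` for some `n`. -/
def IsNilpotent : Prop := ∃ n, A.one ∈ I.annPow n Fr.pt

/-- The quotient algebra `A / I`. -/
def quot : AnAlg H where
  obj P := A.obj P ⧸ I.carrier P
  map {P Q} f := QuotientAddGroup.map (I.carrier Q) (I.carrier P) (A.map f)
    (fun _ hx => I.map_mem f hx)
  map_id {P} x := by
    induction x using QuotientAddGroup.induction_on with
    | H x => exact congrArg _ (A.map_id x)
  map_comp {P Q R} f g x := by
    induction x using QuotientAddGroup.induction_on with
    | H x => exact congrArg _ (A.map_comp f g x)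
  map_add {P Q} f g x := by
    induction x using QuotientAddGroup.induction_on with
    | H x => exact congrArg _ (A.map_add f g x)
  mul {P Q} := QuotientAddGroup.lift (I.carrier P)
    { toFun := fun a => QuotientAddGroup.map (I.carrier Q) (I.carrier (P.tensor Q)) (A.mul a)
        (fun _ hx => I.mul_mem a hx)
      map_zero' := by
        ext x
        simp
      map_add' := fun a b => by
        ext x
        exact congrArg (QuotientAddGroup.mk' (I.carrier (P.tensor Q)))
          (DFunLike.congr_fun (map_add A.mul a b) x) }
    (fun x hx => by
      ext a
      exact (QuotientAddGroup.eq_zero_iff _).2 (I.mul_mem' hx a))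
  one := (A.one : A.obj Fr.pt)
  mul_map f a b := by
    induction a using QuotientAddGroup.induction_on with
    | H a =>
      induction b using QuotientAddGroup.induction_on with
      | H b => exact congrArg _ (A.mul_map f a b)
  mul_comm a b := by
    induction a using QuotientAddGroup.induction_on with
    | H a =>
      induction b using QuotientAddGroup.induction_on with
      | H b => exact congrArg _ (A.mul_comm a b)
  mul_assoc a b c := by
    induction a using QuotientAddGroup.induction_on with
    | H a =>
      induction b using QuotientAddGroup.induction_on with
      | H b =>
        induction c using QuotientAddGroup.induction_on with
        | H c => exact congrArg _ (A.mul_assoc a b c)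
  one_mul a := by
    induction a using QuotientAddGroup.induction_on with
    | H a => exact congrArg _ (A.one_mul a)

/-- The projection `A → A / I`. -/
def proj : A ⟶ I.quot :=
  AnAlg.Hom.mk (fun P => QuotientAddGroup.mk' (I.carrier P)) (fun _ _ => rfl) (fun _ _ => rfl) rfl

/-- The homomorphism `A / I → B` induced by a homomorphism `A → B` that vanishes on `I`. -/
def lift {B : AnAlg H} (f : A ⟶ B) (h : ∀ P, ∀ x ∈ I.carrier P, AnAlg.app f P x = 0) :
    I.quot ⟶ B :=
  AnAlg.Hom.mk (fun P => QuotientAddGroup.lift (I.carrier P) (AnAlg.app f P) (h P))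
    (fun g x => by
      induction x using QuotientAddGroup.induction_on with
      | H x => exact AnAlg.app_map f g x)
    (fun a b => by
      induction a using QuotientAddGroup.induction_on with
      | H a =>
        induction b using QuotientAddGroup.induction_on with
        | H b => exact AnAlg.app_mul f a b)
    (AnAlg.Hom.map_one f)

@[simp] theorem proj_lift {B : AnAlg H} (f : A ⟶ B)
    (h : ∀ P, ∀ x ∈ I.carrier P, AnAlg.app f P x = 0) : I.proj ≫ I.lift f h = f := rfl

theorem quot_hom_ext {B : AnAlg H} {f g : I.quot ⟶ B} (h : I.proj ≫ f = I.proj ≫ g) : f = g := by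
  refine AnAlg.hom_ext fun P x => ?_
  induction x using QuotientAddGroup.induction_on with
  | H x => exact congrArg (fun k => AnAlg.app k P x) h

theorem proj_eq_zero {P : Fr H} {x : A.obj P} (hx : x ∈ I.carrier P) : AnAlg.app I.proj P x = 0 :=
  (QuotientAddGroup.eq_zero_iff x).2 hx

end AnIdeal

/-- A nilpotent ideal together with a divided power structure. -/
structure PDIdeal (A : AnAlg H) where
  ideal : AnIdeal A
  nilpotent : ideal.IsNilpotent
  pd : DividedPowers ideal.pt

/-- `(I, γ) ≤ (J, δ)` if `I ⊆ J` and `δ` restricts to `γ`. -/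
instance (A : AnAlg H) : Preorder (PDIdeal A) where
  le I J := (∀ P, I.ideal.carrier P ≤ J.ideal.carrier P) ∧
    ∀ n, ∀ x ∈ I.ideal.pt, I.pd.dpow n x = J.pd.dpow n x
  le_refl I := ⟨fun _ => le_rfl, fun _ _ _ => rfl⟩
  le_trans I J K h h' := ⟨fun P => (h.1 P).trans (h'.1 P), fun n x hx =>
    (h.2 n x hx).trans (h'.2 n x (h.1 Fr.pt hx))⟩

/-- The zero ideal with its divided power structure. -/
def PDIdeal.zero (A : AnAlg H) : PDIdeal A where
  ideal :=
    { carrier := fun _ => ⊥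
      map_mem := fun f x hx => by
        rw [AddSubgroup.mem_bot] at hx ⊢
        rw [hx, map_zero]
      mul_mem := fun a x hx => by
        rw [AddSubgroup.mem_bot] at hx ⊢
        rw [hx, map_zero] }
  nilpotent := ⟨1, fun Q x hx => by
    rw [AddSubgroup.mem_bot] at hx
    rw [hx, map_zero]
    rfl⟩
  pd := (dividedPowersBot A.Pt).ofRingEquiv (e := RingEquiv.refl A.Pt) (by
    ext x
    simp
    rfl)

/-- A module over `A` in the left heart of ind-Banach `H`-modules. -/
structure ModOver (A : AnAlg H) extends AnMod H where
  smul : ∀ {P Q : Fr H}, A.obj P →+ obj Q →+ obj (P.tensor Q)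
  map_smul : ∀ {P P' Q : Fr H} (f : P ⟶ P') (a : A.obj P') (x : obj Q),
    smul (A.map f a) x = map (rTensor f Q) (smul a x)
  smul_map : ∀ {P Q Q' : Fr H} (g : Q ⟶ Q') (a : A.obj P) (x : obj Q'),
    smul a (map g x) = map (lTensor P g) (smul a x)
  mul_smul : ∀ {P Q R : Fr H} (a : A.obj P) (b : A.obj Q) (x : obj R),
    smul (A.mul a b) x = map (assoc P Q R) (smul a (smul b x))
  one_smul : ∀ {P : Fr H} (x : obj P), smul A.one x = map (leftUnit P) x

/-- The `A`-linear maps from an `A`-module `M` to a `B`-module `N`, viewed as an `A`-module through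
`ρ : A → B`. -/
@[ext] structure LinOver {A B : AnAlg H} (ρ : A ⟶ B) (M : ModOver A) (N : ModOver B) where
  app : ∀ P, M.obj P →+ N.obj P
  naturality : ∀ {P Q : Fr H} (f : P ⟶ Q) (x : M.obj Q), app P (M.map f x) = N.map f (app Q x)
  map_smul : ∀ {P Q : Fr H} (a : A.obj P) (x : M.obj Q),
    app (P.tensor Q) (M.smul a x) = N.smul (AnAlg.app ρ P a) (app Q x)

end AnalyticAlgebras


section Simplicial

variable (H : Type u) [NormedCommRing H]

/-- The category of simplicial commutative algebras over ind-Banach `H`-modules. -/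
abbrev SAlg : Type (u + 2) := SimplicialObject (AnAlg H)

variable {H}

/-- The Moore cycles in degree `n`: the families killed by all proper faces. -/
def cycles (R : SAlg H) (n : ℕ) (P : Fr H) : AddSubgroup ((R _⦋n⦌).obj P) where
  carrier := {x | ∀ (m : ℕ) (θ : ⦋m⦌ ⟶ ⦋n⦌), m < n → AnAlg.app (R.map θ.op) P x = 0}
  zero_mem' := fun _ _ _ => map_zero _
  add_mem' := fun {x y} hx hy m θ h => by rw [map_add, hx m θ h, hy m θ h, add_zero]
  neg_mem' := fun {x} hx m θ h => by rw [map_neg, hx m θ h, neg_zero]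

/-- The Moore boundaries in degree `n`: the elements `d₀ y` where `dᵢ y = 0` for all `i > 0`. -/
def boundaries (R : SAlg H) (n : ℕ) (P : Fr H) : AddSubgroup ((R _⦋n⦌).obj P) where
  carrier := {x | ∃ y : (R _⦋n + 1⦌).obj P, AnAlg.app (R.δ 0) P y = x ∧
    ∀ i : Fin (n + 1), AnAlg.app (R.δ i.succ) P y = 0}
  zero_mem' := ⟨0, map_zero _, fun _ => map_zero _⟩
  add_mem' := by
    rintro _ _ ⟨y, rfl, hy⟩ ⟨z, rfl, hz⟩
    exact ⟨y + z, map_add _ _ _, fun i => by rw [map_add, hy, hz, add_zero]⟩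
  neg_mem' := by
    rintro _ ⟨y, rfl, hy⟩
    exact ⟨-y, map_neg _ _, fun i => by rw [map_neg, hy, neg_zero]⟩

/-- The homotopy group `π_n(R)(P) = π_n(Hom(P, R))`. -/
def PiObj (R : SAlg H) (n : ℕ) (P : Fr H) : Type (u + 1) :=
  cycles R n P ⧸ (boundaries R n P).addSubgroupOf (cycles R n P)

instance (R : SAlg H) (n : ℕ) (P : Fr H) : AddCommGroup (PiObj R n P) :=
  inferInstanceAs (AddCommGroup (cycles R n P ⧸ (boundaries R n P).addSubgroupOf (cycles R n P)))

/-- The class of a cycle. -/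
def PiObj.mk {R : SAlg H} {n : ℕ} {P : Fr H} : cycles R n P →+ PiObj R n P :=
  QuotientAddGroup.mk' _

theorem PiObj.ind {R : SAlg H} {n : ℕ} {P : Fr H} {motive : PiObj R n P → Prop}
    (h : ∀ x : cycles R n P, motive (PiObj.mk x)) (x : PiObj R n P) : motive x :=
  QuotientAddGroup.induction_on x h

/-- A homomorphism that respects cycles and boundaries induces one on homotopy groups. -/
def PiObj.lift {R S : SAlg H} {n : ℕ} {P Q : Fr H} (f : (R _⦋n⦌).obj P →+ (S _⦋n⦌).obj Q)
    (h : ∀ x ∈ cycles R n P, f x ∈ cycles S n Q)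
    (h' : ∀ x ∈ boundaries R n P, f x ∈ boundaries S n Q) : PiObj R n P →+ PiObj S n Q :=
  QuotientAddGroup.map _ _ ((f.comp (cycles R n P).subtype).codRestrict (cycles S n Q)
    fun x => h x.1 x.2) fun x hx => h' x.1 hx

theorem PiObj.lift_mk {R S : SAlg H} {n : ℕ} {P Q : Fr H}
    (f : (R _⦋n⦌).obj P →+ (S _⦋n⦌).obj Q)
    (h : ∀ x ∈ cycles R n P, f x ∈ cycles S n Q)
    (h' : ∀ x ∈ boundaries R n P, f x ∈ boundaries S n Q) (x : cycles R n P) :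
    PiObj.lift f h h' (PiObj.mk x) = PiObj.mk ⟨f x.1, h x.1 x.2⟩ := rfl

/-- The iterated degeneracy `R_0 → R_n`. -/
def degen (R : SAlg H) (n : ℕ) : R _⦋0⦌ ⟶ R _⦋n⦌ :=
  R.map (SimplexCategory.const ⦋n⦌ ⦋0⦌ 0).op

theorem degen_map (R : SAlg H) {m n : ℕ} (θ : ⦋m⦌ ⟶ ⦋n⦌) :
    degen R n ≫ R.map θ.op = degen R m := by
  unfold degen
  rw [← R.map_comp, ← op_comp]
  rfl

theorem degen_zero (R : SAlg H) : degen R 0 = 𝟙 _ := by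
  unfold degen
  rw [Subsingleton.elim (SimplexCategory.const ⦋0⦌ ⦋0⦌ 0) (𝟙 _), op_id, R.map_id]

/-- The homotopy module `π_n(R)`, with the action of `R_0` through degeneracies (which factors
through `π_0(R)`). -/
def piMod (R : SAlg H) (n : ℕ) : ModOver (R _⦋0⦌) where
  obj P := PiObj R n P
  map {P Q} f := PiObj.lift ((R _⦋n⦌).map f)
    (fun x hx m θ h => by rw [AnAlg.app_map, hx m θ h, map_zero])
    (by
      rintro _ ⟨y, rfl, hy⟩
      exact ⟨(R _⦋n + 1⦌).map f y, AnAlg.app_map _ _ _, fun i => by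
        rw [AnAlg.app_map, hy, map_zero]⟩)
  map_id x := by
    induction x using PiObj.ind with
    | h x => exact congrArg PiObj.mk (Subtype.ext ((R _⦋n⦌).map_id x.1))
  map_comp f g x := by
    induction x using PiObj.ind with
    | h x => exact congrArg PiObj.mk (Subtype.ext ((R _⦋n⦌).map_comp f g x.1))
  map_add f g x := by
    induction x using PiObj.ind with
    | h x => exact congrArg PiObj.mk (Subtype.ext ((R _⦋n⦌).map_add f g x.1))
  smul {P Q} :=
    { toFun := fun a => PiObj.lift ((R _⦋n⦌).mul (AnAlg.app (degen R n) P a))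
        (fun x hx m θ h => by rw [AnAlg.app_mul, hx m θ h, map_zero])
        (by
          rintro _ ⟨y, rfl, hy⟩
          refine ⟨(R _⦋n + 1⦌).mul (AnAlg.app (degen R (n + 1)) P a) y, ?_, fun i => ?_⟩
          · rw [AnAlg.app_mul, ← AnAlg.app_comp]
            exact congrArg (fun k => (R _⦋n⦌).mul (AnAlg.app k P a) _) (degen_map R _)
          · rw [AnAlg.app_mul, hy, map_zero])
      map_zero' := by
        ext x
        induction x using PiObj.ind with
        | h x => exact (congrArg PiObj.mk (Subtype.ext (by simp))).trans (map_zero _)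
      map_add' := fun a b => by
        ext x
        induction x using PiObj.ind with
        | h x => exact (congrArg PiObj.mk (Subtype.ext (by
            simp only [map_add]
            rfl))).trans (map_add PiObj.mk _ _) }
  map_smul f a x := by
    induction x using PiObj.ind with
    | h x => exact congrArg PiObj.mk (Subtype.ext (by
        simp only [AnAlg.app_map]; exact (R _⦋n⦌).mul_map f _ x.1))
  smul_map g a x := by
    induction x using PiObj.ind with
    | h x => exact congrArg PiObj.mk (Subtype.ext ((R _⦋n⦌).mul_map_right g _ x.1))
  mul_smul a b x := by
    induction x using PiObj.ind with
    | h x => exact congrArg PiObj.mk (Subtype.ext (by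
        simp only [AnAlg.app_mul]; exact (R _⦋n⦌).mul_assoc _ _ x.1))
  one_smul x := by
    induction x using PiObj.ind with
    | h x => exact congrArg PiObj.mk (Subtype.ext (by
        have h1 : AnAlg.app (degen R n) Fr.pt (R _⦋0⦌).one = (R _⦋n⦌).one :=
          AnAlg.Hom.map_one _
        simp only [h1]; exact (R _⦋n⦌).one_mul x.1))

/-- The map `π_n(R)(P) → π_n(S)(P)` induced by a morphism. -/
def piMap {R S : SAlg H} (f : R ⟶ S) (n : ℕ) (P : Fr H) : PiObj R n P →+ PiObj S n P :=
  PiObj.lift (AnAlg.app (f.app (op ⦋n⦌)) P)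
    (fun x hx m θ h => by
      rw [← AnAlg.app_comp, ← f.naturality, AnAlg.app_comp, hx m θ h, map_zero])
    (by
      rintro _ ⟨y, rfl, hy⟩
      refine ⟨AnAlg.app (f.app (op ⦋n + 1⦌)) P y, ?_, fun i => ?_⟩
      · rw [← AnAlg.app_comp, ← AnAlg.app_comp]
        exact congrArg (fun k => AnAlg.app k P y) (f.naturality _).symm
      · rw [← AnAlg.app_comp]
        refine (congrArg (fun k => AnAlg.app k P y) (f.naturality _).symm).trans ?_
        exact (congrArg (AnAlg.app (f.app (op ⦋n⦌)) P) (hy i)).trans (map_zero _))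

/-- Weak equivalences: the morphisms that induce isomorphisms on all homotopy groups, i.e. weak
equivalences of simplicial sets `Hom(P, R) → Hom(P, S)` for the projective generators `P`. -/
def weq (H : Type u) [NormedCommRing H] : MorphismProperty (SAlg H) :=
  fun _ _ f => ∀ n P, Function.Bijective (piMap f n P)

/-- The ideal of `R_0` generated by the differences of the two faces of elements of `R_1`. -/
def pi0Ideal (R : SAlg H) : AnIdeal (R _⦋0⦌) where
  carrier P := (AnAlg.app (R.δ (0 : Fin 2)) P - AnAlg.app (R.δ (1 : Fin 2)) P).range
  map_mem := by
    rintro P Q f _ ⟨y, rfl⟩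
    refine ⟨(R _⦋1⦌).map f y, ?_⟩
    simp [AnAlg.app_map]
  mul_mem := by
    rintro P Q a _ ⟨y, rfl⟩
    refine ⟨(R _⦋1⦌).mul (AnAlg.app (degen R 1) P a) y, ?_⟩
    have h : ∀ i : Fin 2, AnAlg.app (R.δ i) P (AnAlg.app (degen R 1) P a) = a := fun i => by
      rw [← AnAlg.app_comp]
      have : degen R 1 ≫ R.δ i = 𝟙 _ := (degen_map R _).trans (degen_zero R)
      rw [this]
      rfl
    simp only [AddMonoidHom.sub_apply, AnAlg.app_mul, h, map_sub]

/-- The algebra `π_0(R)`. -/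
def pi0 (R : SAlg H) : AnAlg H := (pi0Ideal R).quot

/-- The morphism `π_0(R) → π_0(S)`. -/
def pi0Map {R S : SAlg H} (f : R ⟶ S) : pi0 R ⟶ pi0 S :=
  (pi0Ideal R).lift (f.app (op ⦋0⦌) ≫ (pi0Ideal S).proj) (by
    rintro P _ ⟨y, rfl⟩
    refine (pi0Ideal S).proj_eq_zero ⟨AnAlg.app (f.app (op ⦋1⦌)) P y, ?_⟩
    simp only [AddMonoidHom.sub_apply, map_sub, ← AnAlg.app_comp]
    congr 1
    · exact congrArg (fun k => AnAlg.app k P y) (f.naturality _).symm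
    · exact congrArg (fun k => AnAlg.app k P y) (f.naturality _).symm)

theorem vertex_proj (R : SAlg H) {n : ℕ} (g : ⦋0⦌ ⟶ ⦋n⦌) :
    R.map g.op ≫ (pi0Ideal R).proj =
      R.map (SimplexCategory.const ⦋0⦌ ⦋n⦌ 0).op ≫ (pi0Ideal R).proj := by
  let e : ⦋1⦌ ⟶ ⦋n⦌ := SimplexCategory.mkOfLe 0 (g.toOrderHom 0) (Fin.zero_le _)
  have h0 : g = SimplexCategory.δ 0 ≫ e := by
    ext i
    fin_cases i
    rfl
  have h1 : SimplexCategory.const ⦋0⦌ ⦋n⦌ 0 = SimplexCategory.δ 1 ≫ e := by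
    ext i
    fin_cases i
    rfl
  rw [h0, h1, op_comp, op_comp, R.map_comp, R.map_comp]
  refine AnAlg.hom_ext fun P x => ?_
  have h := (pi0Ideal R).proj_eq_zero (P := P) ⟨AnAlg.app (R.map e.op) P x, rfl⟩
  rw [AddMonoidHom.sub_apply, map_sub, sub_eq_zero] at h
  exact h

/-- The canonical morphism from `R` to the constant simplicial algebra `π_0(R)`. -/
def toPi0 (R : SAlg H) : R ⟶ (SimplicialObject.const (AnAlg H)).obj (pi0 R) :=
  (SimplicialObject.augment R (pi0 R) (pi0Ideal R).proj fun _ g₁ g₂ =>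
    (vertex_proj R g₁).trans (vertex_proj R g₂).symm).hom

/-- The simplicial algebra map from `R` to the constant simplicial algebra `π_0(R) / I`. -/
def toThick (R : SAlg H) (I : AnIdeal (pi0 R)) :
    R ⟶ (SimplicialObject.const (AnAlg H)).obj I.quot :=
  toPi0 R ≫ (SimplicialObject.const (AnAlg H)).map I.proj

/-- The functor sending a nilpotent PD-ideal `(I, γ)` of `π_0(R)` to the arrow `R → π_0(R) / I`. -/
def thick (R : SAlg H) : PDIdeal (pi0 R) ⥤ Arrow (SAlg H) where
  obj I := Arrow.mk (toThick R I.ideal)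
  map {I J} h := Arrow.homMk (𝟙 R) ((SimplicialObject.const (AnAlg H)).map
    (I.ideal.lift J.ideal.proj fun P _ hx => J.ideal.proj_eq_zero (h.le.1 P hx))) (by
      simp only [Arrow.mk_hom, toThick, Category.assoc, ← Functor.map_comp,
        AnIdeal.proj_lift]
      rfl)
  map_id I := by
    ext1
    · rfl
    · refine (congrArg (SimplicialObject.const (AnAlg H)).map
        (I.ideal.quot_hom_ext (g := 𝟙 _) ?_)).trans (CategoryTheory.Functor.map_id _ _)
      rfl
  map_comp {I J K} h k := by
    ext1
    · exact (Category.id_comp _).symm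
    · refine (congrArg (SimplicialObject.const (AnAlg H)).map
        (I.ideal.quot_hom_ext (g := _ ≫ _) ?_)).trans (Functor.map_comp _ _ _)
      rfl

/-- Weak equivalences of arrows: both components are weak equivalences. -/
def weqArrow (H : Type u) [NormedCommRing H] : MorphismProperty (Arrow (SAlg H)) :=
  fun _ _ φ => weq H φ.left ∧ weq H φ.right

/-- The constant arrow `id_R` on `R`. -/
def idArrow (H : Type u) [NormedCommRing H] : SAlg H ⥤ Arrow (SAlg H) where
  obj R := Arrow.mk (𝟙 R)
  map f := Arrow.homMk f f (by simp)

theorem idArrow_inverts (H : Type u) [NormedCommRing H] :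
    (weq H).IsInvertedBy (idArrow H ⋙ (weqArrow H).Q) :=
  fun _ _ f hf => (weqArrow H).Q_inverts ((idArrow H).map f) ⟨hf, hf⟩

/-- `π_0(X(R))` for `X = Spec B`, where `X(R)` is the mapping space `Map(B, R)` of the `∞`-category
presented by `SAlg H`: the set of morphisms `B → R` in the homotopy category. -/
def Pi0Spec (B R : SAlg H) := (weq H).Q.obj B ⟶ (weq H).Q.obj R

/-- For `f : A → B`, i.e. `X = Spec B → Y = Spec A`, the functor sending a nilpotent PD-ideal `(I, γ)`
of `π_0(R)` to `π_0` of the homotopy fibre product `X(π_0(R) / I) ×_{Y(π_0(R) / I)} Y(R)`.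
This fibre product is the space of homotopy commutative squares from `f : A → B` to
`R → π_0(R) / I`, i.e. a mapping space in the `∞`-category of arrows. -/
def pi0FiberProduct {A B : SAlg H} (f : A ⟶ B) (R : SAlg H) : PDIdeal (pi0 R) ⥤ Type _ :=
  thick R ⋙ (weqArrow H).Q ⋙ coyoneda.obj (op ((weqArrow H).Q.obj (Arrow.mk f)))

/-- `π_0(Y_{X,crys}(R))`: the colimit over all nilpotent PD-ideals `(I, γ)` of `π_0(R)`. -/
def Pi0Crys {A B : SAlg H} (f : A ⟶ B) (R : SAlg H) := (pi0FiberProduct f R).ColimitType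

/-- The map from `π_0(X(R))` to the term with index `(I, γ)`: it sends `x : B → R` to the square with
upper edge `A → B → R` and lower edge `B → R → π_0(R) / I`. -/
def toFiberProduct {A B : SAlg H} (f : A ⟶ B) (R : SAlg H) (I : PDIdeal (pi0 R))
    (x : Pi0Spec B R) : (pi0FiberProduct f R).obj I :=
  (weqArrow H).Q.map (Arrow.homMk f (𝟙 B) (by rfl) : Arrow.mk f ⟶ (idArrow H).obj B) ≫
    (Localization.Construction.lift _ (idArrow_inverts H)).map x ≫
    (weqArrow H).Q.map (Arrow.homMk (𝟙 R) (toThick R I.ideal) (by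
      change 𝟙 R ≫ toThick R I.ideal = 𝟙 R ≫ toThick R I.ideal
      rfl) : (idArrow H).obj R ⟶ (thick R).obj I)

/-- The canonical map `π_0(X(R)) → π_0(Y_{X,crys}(R))`. -/
def toCrys {A B : SAlg H} (f : A ⟶ B) (R : SAlg H) (x : Pi0Spec B R) : Pi0Crys f R :=
  (pi0FiberProduct f R).ιColimitType (PDIdeal.zero (pi0 R))
    (toFiberProduct f R (PDIdeal.zero (pi0 R)) x)

/-- `φ : A → B` extends to a surjection `A⟨X₁, …, X_d⟩ → B` for some `d`.  A homomorphism
`H⟨X₁, …, X_d⟩ → B` is a family `μ ∈ B(ℕᵈ)` that is multiplicative and unital (the images of the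
monomials); `a ⊗ X^ν ↦ φ(a) μ_ν` is surjective from `A ⊗ H⟨X₁, …, X_d⟩` if all families
in `B` come from some family `Q` in `A` by a morphism `P → Q ⊗ c₀(ℕᵈ)`. -/
def IsTateQuotient [IsUltrametricDist H] {A B : AnAlg H} (φ : A ⟶ B) : Prop :=
  ∃ (d : ℕ) (μ : B.obj (tate d)), B.map (tateOne d) μ = B.one ∧
    B.map (tateMul d) μ = B.mul μ μ ∧
    ∀ (P : Fr H) (b : B.obj P), ∃ (Q : Fr H) (a : A.obj Q) (m : P ⟶ Q.tensor (tate d)),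
      b = B.map m (B.mul (AnAlg.app φ Q a) μ)

/-- `π_0(B) ⊗_{π_0(A)} π_n(A) → π_n(B)` is an isomorphism: `π_n(A) → π_n(B)` is universal among the
linear maps from `π_n(A)` to `π_0(B)`-modules. -/
def IsStrongAt {A B : SAlg H} (f : A ⟶ B) (n : ℕ) : Prop :=
  ∀ (M : ModOver (pi0 B)) (φ : LinOver ((pi0Ideal A).proj ≫ pi0Map f) (piMod A n) M),
    ∃! ψ : LinOver (pi0Ideal B).proj (piMod B n) M,
      ∀ (P : Fr H) (x : PiObj A n P), ψ.app P (piMap f n P x) = φ.app P x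

/-- `A → B` is affinoid: `π_0(B)` is a quotient of some `π_0(A)⟨X₁, …, X_d⟩`, and
`π_0(B) ⊗_{π_0(A)} π_n(A) ≅ π_n(B)` for all `n`. -/
structure IsAffinoid [IsUltrametricDist H] {A B : SAlg H} (f : A ⟶ B) : Prop where
  tate : IsTateQuotient (pi0Map f)
  strong : ∀ n, IsStrongAt f n

/-- `Spec B → Spec A` is PD intrinsic étale: it is affinoid, and
`π_0(X(R)) → π_0(Y_{X,crys}(R))` is bijective for all `R`, where `X = Spec B`, `Y = Spec A`. -/
structure IsPDIntrinsicEtale [IsUltrametricDist H] {A B : SAlg H} (f : A ⟶ B) : Prop where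
  affinoid : IsAffinoid f
  bijective : ∀ R : SAlg H, Function.Bijective (toCrys f R)

end Simplicial

end AnGeom

end

/-! The two clauses of the definition are handled independently. Affinoid morphisms compose because
a Tate algebra in `d` variables with `e` further variables adjoined is one in `d + e` variables
(`IsTateQuotient.comp`), and because base change is transitive (`IsStrongAt.comp`).

For the crystalline clause, the decisive fact is that the constant simplicial algebra on `π_0(R)/I`
is local: maps into it already turn weak equivalences into bijections (`isLocalObj_cst`). The space
`Y(π_0(R)/I)` therefore contributes no homotopies to the fibre product, and `π_0` of the homotopy
fibre product is the plain set of pairs `(α : A → R, σ : B → π_0(R)/I)` in the homotopy category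
that agree on `A → π_0(R)/I` (`fp_ext`, `exists_fp`). In the model used here this says that
morphisms in the localized category of arrows, into an arrow with local target, are the commutative
squares in the localized category (`IsLocalObj.arrow_hom_ext`, `IsLocalObj.exists_arrow_hom`).

The colimit is then removed: the crystalline clause for all `R` is equivalent to bijectivity of
`fpPoint f R I` for all `R` and every single `I` (`fpPoint_bijective`, `toCrys_bijective`). No
directedness of the index order is used; it is replaced by injectivity of the transition maps. For
`I ≤ J` this injectivity comes from applying the hypothesis to the constant algebra `π_0(R)/I` with
the image of `J`, which is again a nilpotent PD-ideal.

With `I` fixed, unique lifting against `R → π_0(R)/I` composes formally: a point for `f ≫ g` is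
lifted first on `B` and then on `C` (`fpPoint_comp_bijective`). -/

noncomputable section

namespace AnGeom

/-! ### The localized category of arrows and its source and target functors. -/

section LocalObjects

universe v₁ u₁

variable {𝒞 : Type u₁} [Category.{v₁} 𝒞] (W : MorphismProperty 𝒞)

/-- The morphisms of arrows both components of which belong to `W`. -/
def levelwise : MorphismProperty (Arrow 𝒞) := fun _ _ φ => W φ.left ∧ W φ.right

theorem leftFunc_inverts : (levelwise W).IsInvertedBy (Arrow.leftFunc ⋙ W.Q) :=
  fun _ _ φ hφ => W.Q_inverts φ.left hφ.1

theorem rightFunc_inverts : (levelwise W).IsInvertedBy (Arrow.rightFunc ⋙ W.Q) :=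
  fun _ _ φ hφ => W.Q_inverts φ.right hφ.2

/-- The source functor on localized categories. -/
def locLeft : (levelwise W).Localization ⥤ W.Localization :=
  Localization.Construction.lift _ (leftFunc_inverts W)

/-- The target functor on localized categories. -/
def locRight : (levelwise W).Localization ⥤ W.Localization :=
  Localization.Construction.lift _ (rightFunc_inverts W)

theorem lift_map_Q {𝒟 : Type*} [Category 𝒟] (G : 𝒞 ⥤ 𝒟) (hG : W.IsInvertedBy G) {X Y : 𝒞}
    (f : X ⟶ Y) : (Localization.Construction.lift G hG).map (W.Q.map f) = G.map f := by
  exact (Functor.congr_hom (Localization.Construction.fac G hG) f).trans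
    ((Category.id_comp _).trans (Category.comp_id _))

/-- The source of a morphism in the localized category of arrows. -/
def mapLeft {X Y : Arrow 𝒞} (u : (levelwise W).Q.obj X ⟶ (levelwise W).Q.obj Y) :
    W.Q.obj X.left ⟶ W.Q.obj Y.left := (locLeft W).map u

/-- The target of a morphism in the localized category of arrows. -/
def mapRight {X Y : Arrow 𝒞} (u : (levelwise W).Q.obj X ⟶ (levelwise W).Q.obj Y) :
    W.Q.obj X.right ⟶ W.Q.obj Y.right := (locRight W).map u

theorem mapLeft_comp {X Y Z : Arrow 𝒞} (u : (levelwise W).Q.obj X ⟶ (levelwise W).Q.obj Y)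
    (v : (levelwise W).Q.obj Y ⟶ (levelwise W).Q.obj Z) :
    mapLeft W (u ≫ v) = mapLeft W u ≫ mapLeft W v := (locLeft W).map_comp u v

theorem mapRight_comp {X Y Z : Arrow 𝒞} (u : (levelwise W).Q.obj X ⟶ (levelwise W).Q.obj Y)
    (v : (levelwise W).Q.obj Y ⟶ (levelwise W).Q.obj Z) :
    mapRight W (u ≫ v) = mapRight W u ≫ mapRight W v := (locRight W).map_comp u v

theorem mapLeft_Q {X Y : Arrow 𝒞} (φ : X ⟶ Y) :
    mapLeft W ((levelwise W).Q.map φ) = W.Q.map φ.left := lift_map_Q _ _ _ φ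

theorem mapRight_Q {X Y : Arrow 𝒞} (φ : X ⟶ Y) :
    mapRight W ((levelwise W).Q.map φ) = W.Q.map φ.right := lift_map_Q _ _ _ φ

theorem mapLeft_id (X : Arrow 𝒞) : mapLeft W (𝟙 ((levelwise W).Q.obj X)) = 𝟙 _ :=
  (locLeft W).map_id _

theorem mapRight_id (X : Arrow 𝒞) : mapRight W (𝟙 ((levelwise W).Q.obj X)) = 𝟙 _ :=
  (locRight W).map_id _

variable {W} in
theorem Q_map_wInv {X Y : 𝒞} (w : X ⟶ Y) (hw : W w) :
    W.Q.map w ≫ Localization.Construction.wInv w hw = 𝟙 _ :=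
  (Localization.Construction.wIso w hw).hom_inv_id

variable {W} in
theorem wInv_Q_map {X Y : 𝒞} (w : X ⟶ Y) (hw : W w) :
    Localization.Construction.wInv w hw ≫ W.Q.map w = 𝟙 _ :=
  (Localization.Construction.wIso w hw).inv_hom_id

theorem mapLeft_wInv {X Y : Arrow 𝒞} (φ : X ⟶ Y) (hφ : levelwise W φ) :
    mapLeft W (Localization.Construction.wInv φ hφ) =
      Localization.Construction.wInv φ.left hφ.1 := by
  rw [← Category.comp_id (mapLeft W _), ← Q_map_wInv φ.left hφ.1, ← Category.assoc, ← mapLeft_Q,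
    ← mapLeft_comp, wInv_Q_map, mapLeft_id, Category.id_comp]

theorem mapRight_wInv {X Y : Arrow 𝒞} (φ : X ⟶ Y) (hφ : levelwise W φ) :
    mapRight W (Localization.Construction.wInv φ hφ) =
      Localization.Construction.wInv φ.right hφ.2 := by
  rw [← Category.comp_id (mapRight W _), ← Q_map_wInv φ.right hφ.2, ← Category.assoc,
    ← mapRight_Q, ← mapRight_comp, wInv_Q_map, mapRight_id, Category.id_comp]

theorem map_comp_of_comm {𝒞 𝒟 : Type*} [Category 𝒞] [Category 𝒟] (F : 𝒞 ⥤ 𝒟) {X Y Z : 𝒞}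
    {φ : X ⟶ Y} {ψ : Y ⟶ Z} {χ : X ⟶ Z} (h : φ ≫ ψ = χ) {T : 𝒟} (v : F.obj Z ⟶ T) :
    F.map φ ≫ F.map ψ ≫ v = F.map χ ≫ v := by
  rw [← h, F.map_comp, Category.assoc]

theorem map_comp_of_square {𝒞 𝒟 : Type*} [Category 𝒞] [Category 𝒟] (F : 𝒞 ⥤ 𝒟)
    {X Y Y' Z : 𝒞} {φ : X ⟶ Y} {ψ : Y ⟶ Z} {φ' : X ⟶ Y'} {ψ' : Y' ⟶ Z}
    (h : φ ≫ ψ = φ' ≫ ψ') {T : 𝒟} (v : F.obj Z ⟶ T) :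
    F.map φ ≫ F.map ψ ≫ v = F.map φ' ≫ F.map ψ' ≫ v := by
  rw [map_comp_of_comm F h, map_comp_of_comm F rfl]

/-- Induction principle for the morphisms of a localized category. -/
theorem localization_induction (S : ∀ ⦃X Y : 𝒞⦄, (W.Q.obj X ⟶ W.Q.obj Y) → Prop)
    (comp : ∀ {X Y Z : 𝒞} (f : W.Q.obj X ⟶ W.Q.obj Y) (g : W.Q.obj Y ⟶ W.Q.obj Z),
      S f → S g → S (f ≫ g))
    (map : ∀ {X Y : 𝒞} (f : X ⟶ Y), S (W.Q.map f))
    (wInv : ∀ {X Y : 𝒞} (w : X ⟶ Y) (hw : W w), S (Localization.Construction.wInv w hw))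
    {X Y : 𝒞} (f : W.Q.obj X ⟶ W.Q.obj Y) : S f := by
  let P : MorphismProperty W.Localization := fun X Y f =>
    @S X.as.obj Y.as.obj f
  have : P.IsStableUnderComposition := ⟨fun f g hf hg => comp f g hf hg⟩
  have h : P = ⊤ := Localization.Construction.morphismProperty_eq_top P
    (fun _ _ f => map f) fun _ _ w hw => wInv w hw
  have : P f := by rw [h]; trivial
  exact this

/-- The structure map of an arrow is a natural transformation from source to target, and inverting
levelwise weak equivalences preserves naturality. This produces the underlying square in the
homotopy category. -/
theorem Q_map_comp_mapRight {X Y : Arrow 𝒞}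
    (u : (levelwise W).Q.obj X ⟶ (levelwise W).Q.obj Y) :
    W.Q.map X.hom ≫ mapRight W u = mapLeft W u ≫ W.Q.map Y.hom := by
  refine localization_induction (levelwise W) (fun X Y u =>
    W.Q.map X.hom ≫ mapRight W u = mapLeft W u ≫ W.Q.map Y.hom) ?_ ?_ ?_ u
  · intro X Y Z u v hu hv
    rw [mapLeft_comp, mapRight_comp, ← Category.assoc, hu, Category.assoc, hv, Category.assoc]
  · intro X Y φ
    rw [mapLeft_Q, mapRight_Q, ← W.Q.map_comp, ← W.Q.map_comp, φ.w]
  · intro X Y φ hφ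
    rw [mapLeft_wInv, mapRight_wInv, ← Category.id_comp (W.Q.map Y.hom ≫ _),
      ← wInv_Q_map φ.left hφ.1, Category.assoc, ← Category.assoc (W.Q.map φ.left),
      ← W.Q.map_comp, φ.w, W.Q.map_comp, Category.assoc, Q_map_wInv, Category.comp_id]

/-! ### Local objects: maps into them are unchanged by localization. -/

/-- `D` is local: mapping into `D` turns the morphisms in `W` into bijections. -/
def IsLocalObj (D : 𝒞) : Prop :=
  ∀ ⦃X Y : 𝒞⦄ (w : X ⟶ Y), W w → Function.Bijective fun y : Y ⟶ D => w ≫ y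

variable {W} {D : 𝒞}

/-- Morphisms from `Q X` to `Q D` come from morphisms `X → D` if `D` is local. -/
theorem IsLocalObj.comp_Q_map (hD : IsLocalObj W D) {X Y : 𝒞} (u : W.Q.obj X ⟶ W.Q.obj Y) :
    ∀ y : Y ⟶ D, ∃ x : X ⟶ D, W.Q.map x = u ≫ W.Q.map y := by
  refine localization_induction W (fun X Y u => ∀ y : Y ⟶ D, ∃ x : X ⟶ D,
    W.Q.map x = u ≫ W.Q.map y) ?_ ?_ ?_ u
  · intro X Y Z f g hf hg z
    obtain ⟨y, hy⟩ := hg z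
    obtain ⟨x, hx⟩ := hf y
    exact ⟨x, by rw [hx, hy, Category.assoc]⟩
  · intro X Y f y
    exact ⟨f ≫ y, W.Q.map_comp _ _⟩
  · intro X Y w hw y
    -- Locality extends the given map along `w`, and the extension represents the inverse of `w`
    -- followed by that map.
    obtain ⟨x, rfl⟩ := (hD w hw).2 y
    refine ⟨x, ?_⟩
    rw [W.Q.map_comp]
    exact ((Localization.Construction.wIso w hw).inv_hom_id_assoc _).symm

theorem IsLocalObj.Q_map_surjective (hD : IsLocalObj W D) {X : 𝒞} (u : W.Q.obj X ⟶ W.Q.obj D) :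
    ∃ x : X ⟶ D, W.Q.map x = u := by
  obtain ⟨x, hx⟩ := hD.comp_Q_map u (𝟙 D)
  exact ⟨x, by rw [hx, W.Q.map_id, Category.comp_id]⟩

theorem IsLocalObj.yoneda_inverts (hD : IsLocalObj W D) :
    W.IsInvertedBy (yoneda.obj D).rightOp := fun X Y w hw => by
  have : IsIso ((yoneda.obj D).map w.op) :=
    (isIso_iff_bijective _).2 (hD w hw)
  exact inferInstanceAs (IsIso ((yoneda.obj D).map w.op).op)

/-- The presheaf represented by `D` inverts `W`, so it factors through the localization. Hence the
action of a morphism on it by precomposition depends only on the image under `Q`, and acting on `𝟙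
D` recovers the morphism. -/
theorem IsLocalObj.Q_map_injective (hD : IsLocalObj W D) {X : 𝒞} {x y : X ⟶ D}
    (h : W.Q.map x = W.Q.map y) : x = y := by
  have h' := congrArg (Localization.Construction.lift _ hD.yoneda_inverts).map h
  rw [lift_map_Q, lift_map_Q] at h'
  have := ConcreteCategory.congr_hom (congrArg Quiver.Hom.unop h') (𝟙 D)
  simpa using this

/-! ### Arrows over a local object and the action of the localized category on them. -/

/-- Arrows `a : X → D`, together with a morphism from `a` to `r` in the localized category
of arrows. -/
abbrev OverLoc (r : Arrow 𝒞) (D X : 𝒞) :=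
  Σ a : X ⟶ D, (levelwise W).Q.obj (Arrow.mk a) ⟶ (levelwise W).Q.obj r

/-- The morphism of arrows over `D` given by a morphism of their sources. -/
def overHom {X Y : 𝒞} (f : X ⟶ Y) (y : Y ⟶ D) : Arrow.mk (f ≫ y) ⟶ Arrow.mk y :=
  Arrow.homMk f (𝟙 D) (by simp)

/-- The morphism of arrows with the same source given by a morphism of their targets. -/
def underHom (X : Arrow 𝒞) {B : 𝒞} (s : X.right ⟶ B) : X ⟶ Arrow.mk (X.hom ≫ s) :=
  Arrow.homMk (𝟙 X.left) s (by simp)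

/-- The source of the morphism to `r`. -/
def OverLoc.left {r : Arrow 𝒞} {X : 𝒞} (p : OverLoc (W := W) r D X) :
    W.Q.obj X ⟶ W.Q.obj r.left := mapLeft W p.2

/-- The target of the morphism to `r`. -/
def OverLoc.right {r : Arrow 𝒞} {X : 𝒞} (p : OverLoc (W := W) r D X) :
    W.Q.obj D ⟶ W.Q.obj r.right := mapRight W p.2

/-- Restriction of an arrow over `D` with a morphism to `r` along a morphism of sources. -/
def OverLoc.restrict {r : Arrow 𝒞} {X Y : 𝒞} (f : X ⟶ Y) (p : OverLoc (W := W) r D Y) :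
    OverLoc (W := W) r D X :=
  ⟨f ≫ p.1, (levelwise W).Q.map (overHom f p.1) ≫ p.2⟩

theorem OverLoc.restrict_left {r : Arrow 𝒞} {X Y : 𝒞} (f : X ⟶ Y)
    (p : OverLoc (W := W) r D Y) : (p.restrict f).left = W.Q.map f ≫ p.left :=
  (mapLeft_comp W _ _).trans (congrArg (· ≫ p.left) (mapLeft_Q W _))

theorem OverLoc.restrict_right {r : Arrow 𝒞} {X Y : 𝒞} (f : X ⟶ Y)
    (p : OverLoc (W := W) r D Y) : (p.restrict f).right = p.right :=
  (mapRight_comp W _ _).trans ((congrArg (· ≫ p.right) ((mapRight_Q W _).trans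
    (W.Q.map_id D))).trans (Category.id_comp _))

/-- The types of `v` and `w` differ by the equality `a = b`; transport along it is expressed by the
arrow morphism with identity components, which keeps heterogeneous equality out of later arguments.
-/
theorem OverLoc.ext {r : Arrow 𝒞} {X : 𝒞} {a b : X ⟶ D} (h : a = b)
    {v : (levelwise W).Q.obj (Arrow.mk a) ⟶ (levelwise W).Q.obj r}
    {w : (levelwise W).Q.obj (Arrow.mk b) ⟶ (levelwise W).Q.obj r}
    (h' : v = (levelwise W).Q.map (Arrow.homMk (𝟙 X) (𝟙 D) (by simp [h])) ≫ w) :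
    (⟨a, v⟩ : OverLoc r D X) = ⟨b, w⟩ := by
  subst h
  subst h'
  refine congrArg (Sigma.mk a) ?_
  refine (congrArg (· ≫ w) ?_).trans (Category.id_comp w)
  exact (congrArg (levelwise W).Q.map (by ext <;> simp)).trans ((levelwise W).Q.map_id _)

theorem OverLoc.restrict_id {r : Arrow 𝒞} {X : 𝒞} (p : OverLoc (W := W) r D X) :
    p.restrict (𝟙 X) = p := by
  obtain ⟨a, v⟩ := p
  exact OverLoc.ext (Category.id_comp a) rfl

theorem OverLoc.restrict_comp {r : Arrow 𝒞} {X Y Z : 𝒞} (f : X ⟶ Y) (g : Y ⟶ Z)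
    (p : OverLoc (W := W) r D Z) : p.restrict (f ≫ g) = (p.restrict g).restrict f := by
  obtain ⟨a, v⟩ := p
  refine OverLoc.ext (Category.assoc f g a) ?_
  refine Eq.trans ?_ (congrArg ((levelwise W).Q.map _ ≫ ·)
    (map_comp_of_comm (levelwise W).Q rfl v).symm)
  refine (map_comp_of_comm (levelwise W).Q ?_ v).symm
  ext
  · exact Category.id_comp (f ≫ g)
  · exact (Category.id_comp _).trans (Category.id_comp (𝟙 D))

variable (W) in
/-- The presheaf of arrows over `D` with a morphism to `r`. -/
def overLoc (r : Arrow 𝒞) (D : 𝒞) : 𝒞ᵒᵖ ⥤ Type (max u₁ v₁) where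
  obj X := OverLoc (W := W) r D X.unop
  map f := TypeCat.ofHom fun p => p.restrict f.unop
  map_id X := ConcreteCategory.hom_ext _ _ fun (p : OverLoc r D X.unop) => p.restrict_id
  map_comp f g := ConcreteCategory.hom_ext _ _ fun (p : OverLoc r D _) => p.restrict_comp g.unop f.unop

theorem overHom_mem [W.ContainsIdentities] {X Y : 𝒞} {w : X ⟶ Y} (hw : W w) (y : Y ⟶ D) :
    levelwise W (overHom w y) :=
  ⟨hw, W.id_mem D⟩

theorem IsLocalObj.exists_restrict [W.ContainsIdentities] (hD : IsLocalObj W D) {r : Arrow 𝒞}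
    {X Y : 𝒞} {w : X ⟶ Y} (hw : W w) (p : OverLoc (W := W) r D X) :
    ∃ q : OverLoc (W := W) r D Y, q.restrict w = p := by
  obtain ⟨a, v⟩ := p
  obtain ⟨b, rfl⟩ := (hD w hw).2 a
  have hi := (levelwise W).Q_inverts _ (overHom_mem hw b)
  exact ⟨⟨b, inv ((levelwise W).Q.map (overHom w b)) ≫ v⟩,
    congrArg (Sigma.mk (w ≫ b)) (IsIso.hom_inv_id_assoc _ _)⟩

/-- Along `w` in `W` the first components correspond by locality of `D`, and the second ones because
`overHom w _` is a levelwise weak equivalence, hence invertible after localization. Consequently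
morphisms of the localized category act on such pairs. -/
theorem IsLocalObj.overLoc_inverts [W.ContainsIdentities] (hD : IsLocalObj W D) (r : Arrow 𝒞) :
    W.IsInvertedBy (overLoc W r D).rightOp := fun X Y w hw => by
  have : IsIso ((overLoc W r D).map w.op) := by
    refine (isIso_iff_bijective _).2 ⟨?_, ?_⟩
    · rintro ⟨a, v⟩ ⟨b, v'⟩ h
      obtain ⟨h, h'⟩ := Sigma.mk.inj_iff.1 h
      obtain rfl := (hD w hw).1 h
      have hi := (levelwise W).Q_inverts _ (overHom_mem hw a)
      exact congrArg (Sigma.mk a) (hi.epi_of_iso.left_cancellation _ _ (eq_of_heq h'))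
    · intro p
      obtain ⟨q, rfl⟩ := hD.exists_restrict hw p
      exact ⟨q, rfl⟩
  exact inferInstanceAs (IsIso ((overLoc W r D).map w.op).op)

section

variable [W.ContainsIdentities] (hD : IsLocalObj W D) (r : Arrow 𝒞)

/-- The action of morphisms of the localized category on arrows over `D` with a morphism
to `r`. -/
def IsLocalObj.act {X Y : 𝒞} (u : W.Q.obj X ⟶ W.Q.obj Y) (p : OverLoc (W := W) r D Y) :
    OverLoc (W := W) r D X :=
  ConcreteCategory.hom
    ((Localization.Construction.lift _ (hD.overLoc_inverts r)).map u).unop p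

theorem IsLocalObj.act_comp {X Y Z : 𝒞} (u : W.Q.obj X ⟶ W.Q.obj Y)
    (v : W.Q.obj Y ⟶ W.Q.obj Z) (p : OverLoc (W := W) r D Z) :
    hD.act r (u ≫ v) p = hD.act r u (hD.act r v p) := by
  unfold IsLocalObj.act
  rw [Functor.map_comp]
  rfl

theorem IsLocalObj.act_Q_map {X Y : 𝒞} (f : X ⟶ Y) (p : OverLoc (W := W) r D Y) :
    hD.act r (W.Q.map f) p = p.restrict f := by
  unfold IsLocalObj.act
  rw [lift_map_Q]
  rfl

theorem IsLocalObj.act_wInv {X Y : 𝒞} (w : X ⟶ Y) (hw : W w) (p : OverLoc (W := W) r D Y) :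
    hD.act r (Localization.Construction.wInv w hw) (p.restrict w) = p := by
  rw [← hD.act_Q_map, ← hD.act_comp, wInv_Q_map, ← W.Q.map_id, hD.act_Q_map]
  exact p.restrict_id

/-- The action only changes the source of the square. In the case of a formal inverse the pair can
be assumed to be a restriction along `w`, where the action simply undoes the restriction. -/
theorem IsLocalObj.act_spec {X Y : 𝒞} (u : W.Q.obj X ⟶ W.Q.obj Y) :
    ∀ p : OverLoc (W := W) r D Y, W.Q.map (hD.act r u p).1 = u ≫ W.Q.map p.1 ∧
      (hD.act r u p).left = u ≫ p.left ∧ (hD.act r u p).right = p.right := by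
  refine localization_induction W (fun X Y u => ∀ p : OverLoc (W := W) r D Y,
    W.Q.map (hD.act r u p).1 = u ≫ W.Q.map p.1 ∧
    (hD.act r u p).left = u ≫ p.left ∧ (hD.act r u p).right = p.right) ?_ ?_ ?_ u
  · intro X Y Z f g hf hg p
    obtain ⟨h1, h2, h3⟩ := hf (hD.act r g p)
    obtain ⟨k1, k2, k3⟩ := hg p
    rw [hD.act_comp, h1, h2, h3, k1, k2, k3, Category.assoc, Category.assoc]
    exact ⟨rfl, rfl, rfl⟩
  · intro X Y f p
    rw [hD.act_Q_map]
    exact ⟨W.Q.map_comp _ _, p.restrict_left f, p.restrict_right f⟩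
  · intro X Y w hw p
    obtain ⟨p, rfl⟩ := hD.exists_restrict hw p
    rw [hD.act_wInv, OverLoc.restrict_left, OverLoc.restrict_right, ← Category.assoc,
      wInv_Q_map, Category.id_comp]
    refine ⟨?_, rfl, rfl⟩
    rw [OverLoc.restrict, W.Q.map_comp, ← Category.assoc, wInv_Q_map, Category.id_comp]

/-- A morphism in the localized category of arrows, followed by a morphism to `r` over `D`. -/
theorem IsLocalObj.act_factor {X Y : Arrow 𝒞}
    (u : (levelwise W).Q.obj X ⟶ (levelwise W).Q.obj Y) :
    ∀ (t : Y.right ⟶ D) (v : (levelwise W).Q.obj (Arrow.mk (Y.hom ≫ t)) ⟶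
      (levelwise W).Q.obj r), ∃ (s : X.right ⟶ D)
      (v' : (levelwise W).Q.obj (Arrow.mk (X.hom ≫ s)) ⟶ (levelwise W).Q.obj r),
      W.Q.map s = mapRight W u ≫ W.Q.map t ∧
      hD.act r (mapLeft W u) ⟨Y.hom ≫ t, v⟩ = ⟨X.hom ≫ s, v'⟩ ∧
      u ≫ (levelwise W).Q.map (underHom Y t) ≫ v = (levelwise W).Q.map (underHom X s) ≫ v' := by
  refine localization_induction (levelwise W) (fun X Y u =>
    ∀ (t : Y.right ⟶ D) (v : (levelwise W).Q.obj (Arrow.mk (Y.hom ≫ t)) ⟶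
      (levelwise W).Q.obj r), ∃ (s : X.right ⟶ D)
      (v' : (levelwise W).Q.obj (Arrow.mk (X.hom ≫ s)) ⟶ (levelwise W).Q.obj r),
      W.Q.map s = mapRight W u ≫ W.Q.map t ∧
      hD.act r (mapLeft W u) ⟨Y.hom ≫ t, v⟩ = ⟨X.hom ≫ s, v'⟩ ∧
      u ≫ (levelwise W).Q.map (underHom Y t) ≫ v =
        (levelwise W).Q.map (underHom X s) ≫ v') ?_ ?_ ?_ u
  · intro X Y Z f g hf hg t v
    obtain ⟨s, v', h1, h2, h3⟩ := hg t v
    obtain ⟨s', v'', k1, k2, k3⟩ := hf s v'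
    refine ⟨s', v'', ?_, ?_, ?_⟩
    · rw [k1, h1, mapRight_comp, Category.assoc]
    · rw [mapLeft_comp, hD.act_comp, h2, k2]
    · rw [Category.assoc, h3, k3]
  · intro X Y f t v
    let φ : Arrow.mk (X.hom ≫ f.right ≫ t) ⟶ Arrow.mk (Y.hom ≫ t) :=
      Arrow.homMk f.left (𝟙 D) (by simp)
    refine ⟨f.right ≫ t, (levelwise W).Q.map φ ≫ v, ?_, ?_, ?_⟩
    · rw [mapRight_Q, W.Q.map_comp]
    · rw [mapLeft_Q, hD.act_Q_map]
      refine OverLoc.ext (by simp) ?_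
      refine (map_comp_of_comm (levelwise W).Q ?_ v).symm
      ext <;> simp [overHom, φ]
    · refine map_comp_of_square (levelwise W).Q ?_ v
      ext <;> simp [underHom, φ]
  · intro X Y w hw t v
    -- Locality extends `t` along `w.right`. The induced morphism `φ` of arrows over `D` is then a
    -- levelwise weak equivalence, so `v` extends along it as well.
    obtain ⟨s, rfl⟩ := (hD w.right hw.2).2 t
    let φ : Arrow.mk (X.hom ≫ w.right ≫ s) ⟶ Arrow.mk (Y.hom ≫ s) :=
      Arrow.homMk w.left (𝟙 D) (by simp)
    have hi : IsIso ((levelwise W).Q.map φ) :=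
      (levelwise W).Q_inverts φ ⟨hw.1, W.id_mem D⟩
    obtain ⟨v, rfl⟩ : ∃ v', v = (levelwise W).Q.map φ ≫ v' :=
      ⟨inv ((levelwise W).Q.map φ) ≫ v, (IsIso.hom_inv_id_assoc _ _).symm⟩
    refine ⟨s, v, ?_, ?_, ?_⟩
    · rw [mapRight_wInv, W.Q.map_comp, ← Category.assoc, wInv_Q_map, Category.id_comp]
    · rw [mapLeft_wInv]
      refine Eq.trans (congrArg _ ?_) (hD.act_wInv r w.left hw.1 ⟨Y.hom ≫ s, v⟩)
      refine OverLoc.ext (by simp) ?_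
      refine (map_comp_of_comm (levelwise W).Q ?_ v).symm
      ext <;> simp [overHom, φ]
    · refine (cancel_epi (Localization.Construction.wIso w hw).hom).1 ?_
      rw [Iso.hom_inv_id_assoc]
      refine map_comp_of_square (levelwise W).Q ?_ v
      ext <;> simp [underHom, φ]

end

/-! ### Morphisms to an arrow with local target are commutative squares. -/

/-- Morphisms in the localized category of arrows to an arrow with local target are determined by
their source and target components. -/
theorem IsLocalObj.arrow_hom_ext [W.ContainsIdentities] (hD : IsLocalObj W D) {X : Arrow 𝒞}
    {R : 𝒞} {r : R ⟶ D} {u v : (levelwise W).Q.obj X ⟶ (levelwise W).Q.obj (Arrow.mk r)}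
    (hl : mapLeft W u = mapLeft W v) (hr : mapRight W u = mapRight W v) : u = v := by
  -- With `t = 𝟙 D` and `v` the image of `ε`, the factorization splits `u` into a change of target,
  -- given by `s`, and a morphism `v'` over `D`. The component `mapRight W u` determines `s`, and
  -- the action of `mapLeft W u` determines `v'`.
  let ε : Arrow.mk (r ≫ 𝟙 D) ⟶ Arrow.mk r := Arrow.homMk (𝟙 R) (𝟙 D) (by simp)
  have key := fun k => hD.act_factor (Arrow.mk r) (X := X) (Y := Arrow.mk r) k (𝟙 D)
    ((levelwise W).Q.map ε)
  have hid : (levelwise W).Q.map (underHom (Arrow.mk r) (𝟙 D)) ≫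
      (levelwise W).Q.map ε = 𝟙 ((levelwise W).Q.obj (Arrow.mk r)) := by
    refine ((levelwise W).Q.map_comp _ _).symm.trans
      ((congrArg (levelwise W).Q.map ?_).trans ((levelwise W).Q.map_id _))
    ext <;> simp [underHom, ε]
  obtain ⟨s, v', h1, h2, h3⟩ := key u
  obtain ⟨t, w', k1, k2, k3⟩ := key v
  rw [hid, Category.comp_id] at h3 k3
  have hst : s = t := hD.Q_map_injective (by rw [h1, k1, hr])
  subst hst
  rw [hl, k2] at h2
  obtain rfl := eq_of_heq (Sigma.mk.inj_iff.1 h2).2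
  rw [h3, k3]

/-- Commutative squares in the localized category lift to the localized category of arrows if
their lower right corner is local. -/
theorem IsLocalObj.exists_arrow_hom [W.ContainsIdentities] (hD : IsLocalObj W D) {X : Arrow 𝒞}
    {R : 𝒞} {r : R ⟶ D} (α : W.Q.obj X.left ⟶ W.Q.obj R) (σ : W.Q.obj X.right ⟶ W.Q.obj D)
    (h : W.Q.map X.hom ≫ σ = α ≫ W.Q.map r) :
    ∃ u : (levelwise W).Q.obj X ⟶ (levelwise W).Q.obj (Arrow.mk r),
      mapLeft W u = α ∧ mapRight W u = σ := by
  obtain ⟨s, rfl⟩ := hD.Q_map_surjective σ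
  -- Pulling the identity square of `r` back along `α` gives an arrow `a` over `D` and a morphism `a
  -- → r` with source `α`. Commutativity of the given square identifies `a` with `X.hom ≫ s`.
  obtain ⟨h1, h2, h3⟩ := hD.act_spec (Arrow.mk r) α ⟨r, 𝟙 _⟩
  generalize hD.act (Arrow.mk r) α ⟨r, 𝟙 _⟩ = p at h1 h2 h3
  obtain ⟨a, v⟩ := p
  obtain rfl : X.hom ≫ s = a := hD.Q_map_injective (by rw [W.Q.map_comp, h, ← h1])
  refine ⟨(levelwise W).Q.map (underHom X s) ≫ v, ?_, ?_⟩
  · rw [mapLeft_comp, mapLeft_Q]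
    refine (congrArg₂ (· ≫ ·) (W.Q.map_id _) h2).trans ((Category.id_comp _).trans ?_)
    exact (congrArg (α ≫ ·) (mapLeft_id W _)).trans (Category.comp_id _)
  · rw [mapRight_comp, mapRight_Q]
    refine (congrArg (W.Q.map s ≫ ·) (h3.trans (mapRight_id W _))).trans (Category.comp_id _)

end LocalObjects

/-! ### Constant simplicial algebras are local. -/

section Discrete

variable {H : Type u} [NormedCommRing H]

/-- A homomorphism of analytic algebras that is bijective on families has an inverse. -/
theorem AnAlg.isIso_of_bijective {A B : AnAlg H} (f : A ⟶ B)
    (hf : ∀ P, Function.Bijective (AnAlg.app f P)) : IsIso f := by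
  let e : ∀ P, A.obj P ≃+ B.obj P := fun P => AddEquiv.ofBijective (AnAlg.app f P) (hf P)
  have he : ∀ P x, AnAlg.app f P ((e P).symm x) = x := fun P x => (e P).apply_symm_apply x
  let g : B ⟶ A := AnAlg.Hom.mk (fun P => (e P).symm.toAddMonoidHom)
    (fun k x => (hf _).1 (by
      rw [AnAlg.app_map]
      exact (he _ _).trans (congrArg (B.map k) (he _ _).symm)))
    (fun a b => (hf _).1 (by
      rw [AnAlg.app_mul]
      exact (he _ _).trans (congrArg₂ (fun x y => B.mul x y) (he _ _).symm (he _ _).symm)))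
    ((hf _).1 ((he _ _).trans (AnAlg.Hom.map_one f).symm))
  exact ⟨g, AnAlg.hom_ext fun P x => (e P).symm_apply_apply x, AnAlg.hom_ext fun P x => he P x⟩

theorem AnIdeal.proj_surjective {A : AnAlg H} (I : AnIdeal A) (P : Fr H) :
    Function.Surjective (AnAlg.app I.proj P) := QuotientAddGroup.mk'_surjective _

theorem AnIdeal.mem_of_proj_eq_zero {A : AnAlg H} (I : AnIdeal A) {P : Fr H} {x : A.obj P}
    (hx : AnAlg.app I.proj P x = 0) : x ∈ I.carrier P := (QuotientAddGroup.eq_zero_iff x).1 hx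

theorem mem_cycles_zero (R : SAlg H) (P : Fr H) (x : (R _⦋0⦌).obj P) : x ∈ cycles R 0 P :=
  fun _ _ h => absurd h (Nat.not_lt_zero _)

theorem δ_degen_one (R : SAlg H) (i : Fin 2) (P : Fr H) (x : (R _⦋0⦌).obj P) :
    AnAlg.app (R.δ i) P (AnAlg.app (degen R 1) P x) = x := by
  rw [← AnAlg.app_comp]
  have : degen R 1 ≫ R.δ i = 𝟙 _ := (degen_map R _).trans (degen_zero R)
  rw [this]
  rfl

/-- This reconciles the two descriptions of `π_0`: Moore boundaries `d₀ y` with `d₁ y = 0`, and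
arbitrary differences `d₀ y - d₁ y`. -/
theorem mem_boundaries_zero (R : SAlg H) (P : Fr H) (x : (R _⦋0⦌).obj P) :
    x ∈ boundaries R 0 P ↔ x ∈ (pi0Ideal R).carrier P := by
  constructor
  · rintro ⟨y, rfl, hy⟩
    exact ⟨y, by
      rw [AddMonoidHom.sub_apply]
      exact (congrArg _ (hy 0)).trans (sub_zero _)⟩
  · rintro ⟨y, rfl⟩
    -- Subtracting the degeneracy of `d₁ y` makes the face `d₁` vanish and turns `d₀ y` into `d₀ y -
    -- d₁ y`.
    refine ⟨y - AnAlg.app (degen R 1) P (AnAlg.app (R.δ (1 : Fin 2)) P y), ?_, fun i => ?_⟩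
    · rw [map_sub]
      exact congrArg _ (δ_degen_one R 0 P _)
    · obtain rfl : i = 0 := Fin.fin_one_eq_zero i
      rw [map_sub]
      exact (congrArg _ (δ_degen_one R 1 P _)).trans (sub_self _)

theorem PiObj.mk_eq_zero {R : SAlg H} {n : ℕ} {P : Fr H} (x : cycles R n P) :
    (PiObj.mk x : PiObj R n P) = 0 ↔ x.1 ∈ boundaries R n P :=
  (QuotientAddGroup.eq_zero_iff x).trans AddSubgroup.mem_addSubgroupOf

theorem pi0Map_bijective {R S : SAlg H} (w : R ⟶ S) (hw : weq H w) (P : Fr H) :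
    Function.Bijective (AnAlg.app (pi0Map w) P) := by
  constructor
  · refine (injective_iff_map_eq_zero _).2 fun x hx => ?_
    obtain ⟨x, rfl⟩ := (pi0Ideal R).proj_surjective P x
    refine (pi0Ideal R).proj_eq_zero ((mem_boundaries_zero R P x).1 ?_)
    have h1 := (mem_boundaries_zero S P _).2 ((pi0Ideal S).mem_of_proj_eq_zero hx)
    refine (PiObj.mk_eq_zero ⟨x, mem_cycles_zero R P x⟩).1 ?_
    refine (injective_iff_map_eq_zero _).1 (hw 0 P).1 _ ?_
    exact (PiObj.mk_eq_zero ⟨_, mem_cycles_zero S P _⟩).2 h1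
  · intro y
    obtain ⟨y, rfl⟩ := (pi0Ideal S).proj_surjective P y
    obtain ⟨x, hx⟩ := (hw 0 P).2 (PiObj.mk ⟨y, mem_cycles_zero S P y⟩)
    induction x using PiObj.ind with
    | h x =>
      refine ⟨AnAlg.app (pi0Ideal R).proj P x.1, ?_⟩
      rw [← sub_eq_zero] at hx
      have h1 := (PiObj.mk_eq_zero (⟨AnAlg.app (w.app (op ⦋0⦌)) P x.1, mem_cycles_zero S P _⟩ -
        ⟨y, mem_cycles_zero S P y⟩)).1 ((map_sub _ _ _).trans hx)
      have h2 := (pi0Ideal S).proj_eq_zero ((mem_boundaries_zero S P _).1 h1)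
      refine sub_eq_zero.1 (Eq.trans ?_ h2)
      exact (map_sub (AnAlg.app (pi0Ideal S).proj P) _ _).symm

theorem pi0Map_isIso {R S : SAlg H} (w : R ⟶ S) (hw : weq H w) : IsIso (pi0Map w) :=
  AnAlg.isIso_of_bijective _ (pi0Map_bijective w hw)

/-- The constant simplicial algebra on an analytic algebra. -/
abbrev cst : AnAlg H ⥤ SAlg H := SimplicialObject.const (AnAlg H)

theorem proj_pi0Map {R S : SAlg H} (f : R ⟶ S) :
    (pi0Ideal R).proj ≫ pi0Map f = f.app (op ⦋0⦌) ≫ (pi0Ideal S).proj := rfl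

theorem pi0Map_comp {R S T : SAlg H} (f : R ⟶ S) (g : S ⟶ T) :
    pi0Map (f ≫ g) = pi0Map f ≫ pi0Map g := by
  refine (pi0Ideal R).quot_hom_ext ?_
  rfl

theorem toPi0_app (R : SAlg H) (n : ℕ) : (toPi0 R).app (op ⦋n⦌) =
    R.map (SimplexCategory.const ⦋0⦌ ⦋n⦌ 0).op ≫ (pi0Ideal R).proj := rfl

theorem toPi0_app_zero (R : SAlg H) : (toPi0 R).app (op ⦋0⦌) = (pi0Ideal R).proj := by
  rw [toPi0_app, Subsingleton.elim (SimplexCategory.const ⦋0⦌ ⦋0⦌ 0) (𝟙 _), op_id, R.map_id]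
  rfl

/-- A morphism to a constant simplicial algebra is determined by its component in degree `0`. -/
theorem hom_cst_ext {R : SAlg H} {D : AnAlg H} {a b : R ⟶ cst.obj D}
    (h : a.app (op ⦋0⦌) = b.app (op ⦋0⦌)) : a = b := by
  refine NatTrans.ext (funext fun ⟨⟨n⟩⟩ => ?_)
  have key : ∀ k : R ⟶ cst.obj D, k.app (op ⦋n⦌) =
      R.map (SimplexCategory.const ⦋0⦌ ⦋n⦌ 0).op ≫ k.app (op ⦋0⦌) := fun k =>
    (k.naturality (SimplexCategory.const ⦋0⦌ ⦋n⦌ 0).op).symm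
  exact (key a).trans ((congrArg _ h).trans (key b).symm)

/-- Together with `exists_desc` this makes `π_0` left adjoint to the constant functor, which reduces
locality of constant algebras to the invariance of `π_0` under weak equivalences. -/
theorem hom_cst_ext' {R : SAlg H} {D : AnAlg H} {a b : pi0 R ⟶ D}
    (h : toPi0 R ≫ cst.map a = toPi0 R ≫ cst.map b) : a = b := by
  refine (pi0Ideal R).quot_hom_ext ?_
  rw [← toPi0_app_zero]
  exact congrArg (fun k : R ⟶ cst.obj D => k.app (op ⦋0⦌)) h

/-- Morphisms to a constant simplicial algebra factor through `π_0`. -/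
theorem exists_desc {R : SAlg H} {D : AnAlg H} (a : R ⟶ cst.obj D) :
    ∃ b : pi0 R ⟶ D, toPi0 R ≫ cst.map b = a := by
  refine ⟨(pi0Ideal R).lift (a.app (op ⦋0⦌)) ?_, hom_cst_ext ?_⟩
  · rintro P _ ⟨y, rfl⟩
    have h : ∀ i : Fin 2, R.δ i ≫ a.app (op ⦋0⦌) = a.app (op ⦋1⦌) := fun i =>
      a.naturality (SimplexCategory.δ i).op
    rw [AddMonoidHom.sub_apply, map_sub, ← AnAlg.app_comp, ← AnAlg.app_comp, sub_eq_zero]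
    exact congrArg (fun k => AnAlg.app k P y) ((h 0).trans (h 1).symm)
  · change (toPi0 R).app (op ⦋0⦌) ≫ _ = _
    rw [toPi0_app_zero]
    rfl

theorem toPi0_naturality {R S : SAlg H} (f : R ⟶ S) :
    f ≫ toPi0 S = toPi0 R ≫ cst.map (pi0Map f) := by
  refine hom_cst_ext ?_
  change f.app (op ⦋0⦌) ≫ (toPi0 S).app (op ⦋0⦌) = (toPi0 R).app (op ⦋0⦌) ≫ pi0Map f
  rw [toPi0_app_zero, toPi0_app_zero]
  rfl

instance : (weq H).ContainsIdentities := ⟨fun R n P => by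
  have : piMap (𝟙 R) n P = AddMonoidHom.id _ := by
    ext x
    induction x using PiObj.ind with
    | h x => rfl
  rw [this]
  exact Function.bijective_id⟩

/-- Constant simplicial algebras are local. -/
theorem isLocalObj_cst (D : AnAlg H) : IsLocalObj (weq H) (cst.obj D) := by
  intro R S w hw
  have := pi0Map_isIso w hw
  constructor
  · intro a b h
    obtain ⟨a, rfl⟩ := exists_desc a
    obtain ⟨b, rfl⟩ := exists_desc b
    dsimp only at h
    rw [← Category.assoc, ← Category.assoc, toPi0_naturality, Category.assoc, Category.assoc,
      ← cst.map_comp, ← cst.map_comp] at h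
    rw [(cancel_epi _).1 (hom_cst_ext' h)]
  · intro a
    obtain ⟨a, rfl⟩ := exists_desc a
    refine ⟨toPi0 S ≫ cst.map (inv (pi0Map w) ≫ a), ?_⟩
    dsimp only
    rw [← Category.assoc, toPi0_naturality, Category.assoc, ← cst.map_comp,
      IsIso.hom_inv_id_assoc]

end Discrete

/-! ### Images of nilpotent PD-ideals. -/

section PDImage

variable {H : Type u} [NormedCommRing H]

/-- The homomorphism of underlying rings. -/
def AnAlg.ptHom {A B : AnAlg H} (q : A ⟶ B) : A.Pt →+* B.Pt where
  toFun := AnAlg.app q Fr.pt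
  map_one' := AnAlg.Hom.map_one q
  map_mul' a b := (AnAlg.app_map q dup (A.mul a b)).trans
    (congrArg (B.map dup) (AnAlg.app_mul q a b))
  map_zero' := map_zero _
  map_add' := map_add (AnAlg.app q Fr.pt)

/-- The image of an ideal under a surjective homomorphism. -/
def AnIdeal.image {A B : AnAlg H} (J : AnIdeal A) (q : A ⟶ B)
    (hq : ∀ P, Function.Surjective (AnAlg.app q P)) : AnIdeal B where
  carrier P := (J.carrier P).map (AnAlg.app q P)
  map_mem := by
    rintro P Q f _ ⟨x, hx, rfl⟩
    exact ⟨A.map f x, J.map_mem f hx, AnAlg.app_map q f x⟩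
  mul_mem := by
    rintro P Q b _ ⟨x, hx, rfl⟩
    obtain ⟨a, rfl⟩ := hq P b
    exact ⟨A.mul a x, J.mul_mem a hx, AnAlg.app_mul q a x⟩

variable {A B : AnAlg H} (J : AnIdeal A) (q : A ⟶ B)
  (hq : ∀ P, Function.Surjective (AnAlg.app q P))

theorem AnIdeal.app_mem_annPow_image (n : ℕ) : ∀ {P : Fr H} {a : A.obj P}, a ∈ J.annPow n P →
    AnAlg.app q P a ∈ (J.image q hq).annPow n P := by
  induction n with
  | zero =>
    rintro P a (rfl : a = 0)
    exact map_zero _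
  | succ n ih =>
    rintro P a ha Q _ ⟨x, hx, rfl⟩
    exact AnAlg.app_mul q a x ▸ ih (ha Q x hx)

theorem AnIdeal.pt_image : (J.image q hq).pt = J.pt.map (AnAlg.ptHom q) := by
  have hs : Function.Surjective (AnAlg.ptHom q) := hq Fr.pt
  exact Ideal.ext fun x => (Ideal.mem_map_iff_of_surjective (I := J.pt) (AnAlg.ptHom q) hs).symm

/-- The image of a nilpotent PD-ideal `J` under a surjective homomorphism whose kernel is a
sub-PD-ideal `I` of `J`. -/
def PDIdeal.image {I J : PDIdeal A} (h : I ≤ J)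
    (hker : ∀ x, AnAlg.app q Fr.pt x = 0 → x ∈ I.ideal.carrier Fr.pt)
    (hI : ∀ x ∈ I.ideal.carrier Fr.pt, AnAlg.app q Fr.pt x = 0) : PDIdeal B where
  ideal := J.ideal.image q hq
  nilpotent := by
    obtain ⟨n, hn⟩ := J.nilpotent
    refine ⟨n, ?_⟩
    have h1 : AnAlg.app q Fr.pt A.one = B.one := AnAlg.Hom.map_one q
    exact h1 ▸ J.ideal.app_mem_annPow_image q hq n hn
  pd := DividedPowers.Quotient.OfSurjective.dividedPowers J.pd (f := AnAlg.ptHom q) (hq Fr.pt)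
    (J.ideal.pt_image q hq)
    { isSubideal := inf_le_right
      dpow_mem := by
        rintro n hn x ⟨hx, hxJ⟩
        have hxI : x ∈ I.ideal.pt := hker x hx
        have h2 := I.pd.dpow_mem hn hxI
        -- Compatibility of the divided powers of `I` and `J` is what makes the kernel stable under
        -- those of `J`, so that they descend to the image.
        rw [h.2 n x hxI] at h2
        exact ⟨hI _ h2, J.pd.dpow_mem hn hxJ⟩ }

theorem PDIdeal.zero_le (I : PDIdeal A) : PDIdeal.zero A ≤ I := by
  constructor
  · rintro P x hx
    obtain rfl : x = 0 := (AddSubgroup.mem_bot).1 hx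
    exact zero_mem _
  · intro n x hx
    obtain rfl : x = 0 := (AddSubgroup.mem_bot).1 hx
    rcases eq_or_ne n 0 with rfl | hn
    · rw [DividedPowers.dpow_zero _ hx, DividedPowers.dpow_zero _ (zero_mem _)]
    · rw [DividedPowers.dpow_eval_zero _ hn, DividedPowers.dpow_eval_zero _ hn]

end PDImage

/-! ### Points of the fibre products, removal of the colimit, and composition. -/

section FiberProducts

variable {H : Type u} [NormedCommRing H] {A B C : SAlg H}

/-- Taking the source of the identity arrow is the identity functor before localization, hence also
after it by uniqueness of the induced functor. -/
theorem idArrow_mapLeft {R S : SAlg H} (x : (weq H).Q.obj R ⟶ (weq H).Q.obj S) :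
    mapLeft (weq H) (X := (idArrow H).obj R) (Y := (idArrow H).obj S)
      ((Localization.Construction.lift _ (idArrow_inverts H)).map x) = x := by
  have h : Localization.Construction.lift _ (idArrow_inverts H) ⋙ locLeft (weq H) =
      𝟭 (weq H).Localization := by
    refine Localization.Construction.uniq _ _ ?_
    refine CategoryTheory.Functor.ext (fun _ => rfl) fun X Y f => ?_
    refine Eq.trans ?_ ((Category.id_comp _).trans (Category.comp_id _)).symm
    exact (congrArg (locLeft (weq H)).map (lift_map_Q _ _ (idArrow_inverts H) f)).trans
      (mapLeft_Q (weq H) ((idArrow H).map f))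
  exact (Functor.congr_hom h x).trans ((Category.id_comp _).trans (Category.comp_id _))

theorem idArrow_mapRight {R S : SAlg H} (x : (weq H).Q.obj R ⟶ (weq H).Q.obj S) :
    mapRight (weq H) (X := (idArrow H).obj R) (Y := (idArrow H).obj S)
      ((Localization.Construction.lift _ (idArrow_inverts H)).map x) = x := by
  have h := Q_map_comp_mapRight (weq H) (X := (idArrow H).obj R) (Y := (idArrow H).obj S)
      ((Localization.Construction.lift _ (idArrow_inverts H)).map x)
  rw [idArrow_mapLeft] at h
  refine Eq.trans ?_ (h.trans ?_)
  · exact ((congrArg (· ≫ _) ((weq H).Q.map_id R)).trans (Category.id_comp _)).symm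
  · exact (congrArg (x ≫ ·) ((weq H).Q.map_id S)).trans (Category.comp_id _)

/-- The component in `π_0(Y(R))` of a point of the fibre product. -/
def fpLeft {f : A ⟶ B} {R : SAlg H} {I : PDIdeal (pi0 R)} (p : (pi0FiberProduct f R).obj I) :
    (weq H).Q.obj A ⟶ (weq H).Q.obj R :=
  mapLeft (weq H) (X := Arrow.mk f) (Y := Arrow.mk (toThick R I.ideal)) p

/-- The component in `π_0(X(π_0(R) / I))` of a point of the fibre product. -/
def fpRight {f : A ⟶ B} {R : SAlg H} {I : PDIdeal (pi0 R)} (p : (pi0FiberProduct f R).obj I) :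
    (weq H).Q.obj B ⟶ (weq H).Q.obj (cst.obj I.ideal.quot) :=
  mapRight (weq H) (X := Arrow.mk f) (Y := Arrow.mk (toThick R I.ideal)) p

theorem fp_comm {f : A ⟶ B} {R : SAlg H} {I : PDIdeal (pi0 R)}
    (p : (pi0FiberProduct f R).obj I) :
    (weq H).Q.map f ≫ fpRight p = fpLeft p ≫ (weq H).Q.map (toThick R I.ideal) :=
  Q_map_comp_mapRight (weq H) (X := Arrow.mk f) (Y := Arrow.mk (toThick R I.ideal)) p

/-- Since `weqArrow H` unfolds to `levelwise (weq H)` and `π_0(R)/I` is local, the general results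
on arrows apply. With `fp_comm` and `exists_fp`, points of the fibre product become commuting pairs
in the homotopy category. -/
theorem fp_ext {f : A ⟶ B} {R : SAlg H} {I : PDIdeal (pi0 R)}
    {p q : (pi0FiberProduct f R).obj I} (hl : fpLeft p = fpLeft q) (hr : fpRight p = fpRight q) :
    p = q :=
  (isLocalObj_cst I.ideal.quot).arrow_hom_ext (X := Arrow.mk f) (r := toThick R I.ideal) hl hr

theorem exists_fp {f : A ⟶ B} {R : SAlg H} {I : PDIdeal (pi0 R)}
    (α : (weq H).Q.obj A ⟶ (weq H).Q.obj R)
    (σ : (weq H).Q.obj B ⟶ (weq H).Q.obj (cst.obj I.ideal.quot))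
    (h : (weq H).Q.map f ≫ σ = α ≫ (weq H).Q.map (toThick R I.ideal)) :
    ∃ p : (pi0FiberProduct f R).obj I, fpLeft p = α ∧ fpRight p = σ :=
  (isLocalObj_cst I.ideal.quot).exists_arrow_hom (X := Arrow.mk f) (r := toThick R I.ideal) α σ h

/-- The map from `π_0(X(R))` to the fibre product with index `I`. -/
def fpPoint (f : A ⟶ B) (R : SAlg H) (I : PDIdeal (pi0 R))
    (x : (weq H).Q.obj B ⟶ (weq H).Q.obj R) : (pi0FiberProduct f R).obj I :=
  toFiberProduct f R I x

theorem fpLeft_fpPoint (f : A ⟶ B) (R : SAlg H) (I : PDIdeal (pi0 R))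
    (x : (weq H).Q.obj B ⟶ (weq H).Q.obj R) :
    fpLeft (fpPoint f R I x) = (weq H).Q.map f ≫ x := by
  refine (mapLeft_comp (weq H) _ _).trans (congrArg₂ (· ≫ ·) (mapLeft_Q (weq H) _) ?_)
  refine (mapLeft_comp (weq H) _ _).trans
    ((congrArg₂ (· ≫ ·) (idArrow_mapLeft x) (mapLeft_Q (weq H) _)).trans ?_)
  exact (congrArg (x ≫ ·) ((weq H).Q.map_id R)).trans (Category.comp_id x)

theorem fpRight_fpPoint (f : A ⟶ B) (R : SAlg H) (I : PDIdeal (pi0 R))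
    (x : (weq H).Q.obj B ⟶ (weq H).Q.obj R) :
    fpRight (fpPoint f R I x) = x ≫ (weq H).Q.map (toThick R I.ideal) := by
  refine (mapRight_comp (weq H) _ _).trans ((congrArg₂ (· ≫ ·) ((mapRight_Q (weq H) _).trans
    ((weq H).Q.map_id B)) ?_).trans (Category.id_comp _))
  exact (mapRight_comp (weq H) _ _).trans
    (congrArg₂ (· ≫ ·) (idArrow_mapRight x) (mapRight_Q (weq H) _))

theorem fpLeft_map {f : A ⟶ B} {R : SAlg H} {I J : PDIdeal (pi0 R)} (h : I ⟶ J)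
    (p : (pi0FiberProduct f R).obj I) : fpLeft ((pi0FiberProduct f R).map h p) = fpLeft p := by
  refine (mapLeft_comp (weq H) _ _).trans
    ((congrArg (fpLeft p ≫ ·) ((mapLeft_Q (weq H) _).trans ?_)).trans (Category.comp_id _))
  exact (weq H).Q.map_id R

theorem fpRight_map {f : A ⟶ B} {R : SAlg H} {I J : PDIdeal (pi0 R)} (h : I ⟶ J)
    (p : (pi0FiberProduct f R).obj I) : fpRight ((pi0FiberProduct f R).map h p) =
      fpRight p ≫ (weq H).Q.map (cst.map (I.ideal.lift J.ideal.proj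
        fun P _ hx => J.ideal.proj_eq_zero (h.le.1 P hx))) :=
  (mapRight_comp (weq H) _ _).trans (congrArg (fpRight p ≫ ·) (mapRight_Q (weq H) _))

theorem toThick_lift (R : SAlg H) {I J : PDIdeal (pi0 R)} (h : I ≤ J) :
    toThick R I.ideal ≫ cst.map (I.ideal.lift J.ideal.proj
      fun P _ hx => J.ideal.proj_eq_zero (h.1 P hx)) = toThick R J.ideal := by
  unfold toThick
  rw [Category.assoc, ← Functor.map_comp, AnIdeal.proj_lift]

theorem map_fpPoint (f : A ⟶ B) (R : SAlg H) {I J : PDIdeal (pi0 R)} (h : I ⟶ J)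
    (x : (weq H).Q.obj B ⟶ (weq H).Q.obj R) :
    (pi0FiberProduct f R).map h (fpPoint f R I x) = fpPoint f R J x := by
  refine fp_ext ?_ ?_
  · rw [fpLeft_map, fpLeft_fpPoint, fpLeft_fpPoint]
  · rw [fpRight_map, fpRight_fpPoint, fpRight_fpPoint, Category.assoc,
      ← Functor.map_comp, toThick_lift R h.le]

/-- The zero PD-ideal, used to define the canonical map, is the least index and the maps `fpPoint`
are compatible with transitions, so any `I` computes the same class. -/
theorem toCrys_eq (f : A ⟶ B) (R : SAlg H) (I : PDIdeal (pi0 R)) (x : (weq H).Q.obj B ⟶ (weq H).Q.obj R) :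
    toCrys f R x = (pi0FiberProduct f R).ιColimitType I (fpPoint f R I x) := by
  rw [← map_fpPoint f R (homOfLE (PDIdeal.zero_le I))]
  exact (Functor.ιColimitType_map _ _ _).symm

theorem fpPoint_injective {f : A ⟶ B} {R : SAlg H}
    (hf : Function.Injective (toCrys f R)) (I : PDIdeal (pi0 R)) :
    Function.Injective (fpPoint f R I) := fun x y h =>
  hf (by rw [toCrys_eq f R I, toCrys_eq f R I, h])

/-- The transition maps between the fibre products are injective if `π_0(X(R)) → π_0(Y_{X,crys}(R))`
is injective for constant `R`. -/
theorem pi0FiberProduct_map_injective {f : A ⟶ B}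
    (hf : ∀ R : SAlg H, Function.Injective (toCrys f R)) {R : SAlg H} {I J : PDIdeal (pi0 R)}
    (h : I ⟶ J) : Function.Injective ((pi0FiberProduct f R).map h) := by
  intro p p' hpp
  have hl := congrArg fpLeft hpp
  have hr := congrArg fpRight hpp
  rw [fpLeft_map, fpLeft_map] at hl
  rw [fpRight_map, fpRight_map] at hr
  refine fp_ext hl ?_
  -- The right components of `p` and `p'` are regarded as points of `X` with values in `S`. They
  -- agree on `A`, since `p` and `p'` have equal left components, and modulo the image `K` of `J`.
  -- Injectivity for `S` and `K` then identifies them.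
  let S : SAlg H := cst.obj I.ideal.quot
  let q : pi0 R ⟶ pi0 S := I.ideal.proj ≫ (pi0Ideal S).proj
  have hq : ∀ P, Function.Surjective (AnAlg.app q P) := fun P =>
    ((pi0Ideal S).proj_surjective P).comp (I.ideal.proj_surjective P)
  let K : PDIdeal (pi0 S) := PDIdeal.image q hq h.le
    (fun x hx => I.ideal.mem_of_proj_eq_zero (by
      obtain ⟨y, hy⟩ := (pi0Ideal S).mem_of_proj_eq_zero hx
      -- Both faces of a constant object are identities, so `pi0Ideal S` is zero and the kernel of
      -- `q` is exactly `I`.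
      exact hy.symm.trans (sub_self _)))
    (fun x hx => (congrArg (AnAlg.app (pi0Ideal S).proj Fr.pt) (I.ideal.proj_eq_zero hx)).trans
      (map_zero _))
  let κ : J.ideal.quot ⟶ K.ideal.quot := J.ideal.lift (q ≫ K.ideal.proj)
    fun P x hx => K.ideal.proj_eq_zero ⟨x, hx, rfl⟩
  have hK : toThick S K.ideal = cst.map (I.ideal.lift J.ideal.proj
      fun P _ hx => J.ideal.proj_eq_zero (h.le.1 P hx)) ≫ cst.map κ := by
    refine hom_cst_ext ?_
    refine (congrArg (· ≫ K.ideal.proj) (toPi0_app_zero S)).trans ?_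
    exact I.ideal.quot_hom_ext rfl
  refine fpPoint_injective (hf S) K (fp_ext ?_ ?_)
  · rw [fpLeft_fpPoint, fpLeft_fpPoint, fp_comm, fp_comm, hl]
  · rw [fpRight_fpPoint, fpRight_fpPoint, hK, Functor.map_comp]
    exact (Category.assoc _ _ _).symm.trans ((congrArg (· ≫ _) hr).trans (Category.assoc _ _ _))

/-- A point `p` has the same class in the colimit as some `x`, but without directedness this does
not directly give equality at a common later index. Injectivity of the transition maps makes the
identity `fpPoint f R I x = p` invariant along every transition, in both directions. -/
theorem fpPoint_bijective {f : A ⟶ B}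
    (hf : ∀ R : SAlg H, Function.Bijective (toCrys f R)) (R : SAlg H) (I : PDIdeal (pi0 R)) :
    Function.Bijective (fpPoint f R I) := by
  refine ⟨fpPoint_injective (hf R).1 I, fun p => ?_⟩
  obtain ⟨x, hx⟩ := (hf R).2 ((pi0FiberProduct f R).ιColimitType I p)
  refine ⟨x, ?_⟩
  -- The predicate "this point comes from `x`" descends to the colimit. It holds at the class of
  -- `x`, hence at the class of `p`.
  let S : Pi0Crys f R → Prop := Quot.lift (fun z => fpPoint f R z.1 x = z.2) (by
    rintro ⟨I, p⟩ ⟨J, q⟩ ⟨(h : I ⟶ J), (hq : q = (pi0FiberProduct f R).map h p)⟩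
    subst hq
    change (fpPoint f R I x = p) = (fpPoint f R J x = (pi0FiberProduct f R).map h p)
    refine propext ⟨?_, fun hJ => ?_⟩
    · rintro rfl
      exact (map_fpPoint f R h x).symm
    · exact pi0FiberProduct_map_injective (fun R => (hf R).1) h
        ((map_fpPoint f R h x).trans hJ))
  have hS : S (toCrys f R x) := rfl
  rw [hx] at hS
  exact hS

theorem toCrys_bijective {f : A ⟶ B} {R : SAlg H}
    (hf : ∀ I, Function.Bijective (fpPoint f R I)) : Function.Bijective (toCrys f R) := by
  constructor
  -- The inverses of the maps `fpPoint` at the various indices are compatible with transitions and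
  -- glue to a left inverse on the colimit.
  · let S : Pi0Crys f R → ((weq H).Q.obj B ⟶ (weq H).Q.obj R) :=
      Quot.lift (fun z => (Equiv.ofBijective _ (hf z.1)).symm z.2) (by
        rintro ⟨I, p⟩ ⟨J, q⟩ ⟨(h : I ⟶ J), (hq : q = (pi0FiberProduct f R).map h p)⟩
        subst hq
        obtain ⟨x, rfl⟩ := (hf I).2 p
        dsimp only
        rw [map_fpPoint, Equiv.ofBijective_symm_apply_apply,
          Equiv.ofBijective_symm_apply_apply])
    exact Function.LeftInverse.injective (g := S) fun x =>
      Equiv.ofBijective_symm_apply_apply _ (hf _) x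
  · intro z
    obtain ⟨I, p, rfl⟩ := (pi0FiberProduct f R).ιColimitType_jointly_surjective z
    obtain ⟨x, rfl⟩ := (hf I).2 p
    exact ⟨x, toCrys_eq f R I x⟩

/-- Bijectivity of `fpPoint` is unique lifting against `R → π_0(R)/I` in the homotopy category, and
such lifting properties compose. -/
theorem fpPoint_comp_bijective {f : A ⟶ B} {g : B ⟶ C} {R : SAlg H} {I : PDIdeal (pi0 R)}
    (hf : Function.Bijective (fpPoint f R I))
    (hg : Function.Bijective (fpPoint g R I)) :
    Function.Bijective (fpPoint (f ≫ g) R I) := by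
  constructor
  · intro x y h
    have hl := congrArg fpLeft h
    have hr := congrArg fpRight h
    rw [fpLeft_fpPoint, fpLeft_fpPoint, Functor.map_comp] at hl
    rw [fpRight_fpPoint, fpRight_fpPoint] at hr
    have hxy : (weq H).Q.map g ≫ x = (weq H).Q.map g ≫ y := by
      refine hf.1 (fp_ext ?_ ?_)
      · rw [fpLeft_fpPoint, fpLeft_fpPoint]
        exact (Category.assoc _ _ _).symm.trans (hl.trans (Category.assoc _ _ _))
      · rw [fpRight_fpPoint, fpRight_fpPoint]
        exact (Category.assoc _ _ _).trans
          ((congrArg (_ ≫ ·) hr).trans (Category.assoc _ _ _).symm)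
    refine hg.1 (fp_ext ?_ ?_)
    · rw [fpLeft_fpPoint, fpLeft_fpPoint, hxy]
    · rw [fpRight_fpPoint, fpRight_fpPoint, hr]
  · intro p
    have hp := fp_comm p
    rw [Functor.map_comp, Category.assoc] at hp
    -- Restricting the component on `C` along `g` gives a point for `f`; its lift `x : B → R` is the
    -- left component of a point for `g`.
    obtain ⟨u, hu, hu'⟩ := exists_fp (f := f) _ _ hp
    obtain ⟨x, rfl⟩ := hf.2 u
    rw [fpLeft_fpPoint] at hu
    rw [fpRight_fpPoint] at hu'
    obtain ⟨v, hv, hv'⟩ := exists_fp (f := g) x (fpRight p) hu'.symm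
    obtain ⟨y, rfl⟩ := hg.2 v
    rw [fpLeft_fpPoint] at hv
    rw [fpRight_fpPoint] at hv'
    refine ⟨y, fp_ext ?_ ?_⟩
    · rw [fpLeft_fpPoint, Functor.map_comp, ← hu, ← hv]
      exact Category.assoc _ _ _
    · rw [fpRight_fpPoint, hv']

end FiberProducts

/-! ### Transitivity of base change for homotopy modules. -/

section Strong

variable {H : Type u} [NormedCommRing H]

/-- Restriction of scalars along a homomorphism of algebras. -/
def ModOver.restrict {A B : AnAlg H} (ρ : A ⟶ B) (M : ModOver B) : ModOver A :=
  { M.toAnMod with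
    smul := fun {P _} => M.smul.comp (AnAlg.app ρ P)
    map_smul := fun f a x => by
      simp only [AddMonoidHom.comp_apply, AnAlg.app_map]
      exact M.map_smul f _ x
    smul_map := fun g a x => M.smul_map g _ x
    mul_smul := fun a b x => by
      simp only [AddMonoidHom.comp_apply, AnAlg.app_mul]
      exact M.mul_smul _ _ x
    one_smul := fun x => by
      have h : AnAlg.app ρ Fr.pt A.one = B.one := AnAlg.Hom.map_one ρ
      simp only [AddMonoidHom.comp_apply, h]
      exact M.one_smul x }

/-- A map linear over `ρ ≫ σ = τ` is linear over `ρ` to the restriction along `σ`. -/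
def LinOver.toRestrict {A B C : AnAlg H} {ρ : A ⟶ B} {σ : B ⟶ C} {τ : A ⟶ C} (h : ρ ≫ σ = τ)
    {M : ModOver A} {N : ModOver C} (φ : LinOver τ M N) : LinOver ρ M (N.restrict σ) where
  app := φ.app
  naturality := φ.naturality
  map_smul a x := by
    subst h
    exact φ.map_smul a x

/-- A map linear over `ρ` to the restriction along `σ` is linear over `ρ ≫ σ = τ`. -/
def LinOver.ofRestrict {A B C : AnAlg H} {ρ : A ⟶ B} {σ : B ⟶ C} {τ : A ⟶ C} (h : ρ ≫ σ = τ)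
    {M : ModOver A} {N : ModOver C} (φ : LinOver ρ M (N.restrict σ)) : LinOver τ M N where
  app := φ.app
  naturality := φ.naturality
  map_smul a x := by
    subst h
    exact φ.map_smul a x

/-- The map `π_n(R) → π_n(S)` is linear over `R_0 → S_0`. -/
theorem piMap_smul {R S : SAlg H} (f : R ⟶ S) (n : ℕ) {P Q : Fr H} (a : (R _⦋0⦌).obj P)
    (x : PiObj R n Q) : piMap f n (P.tensor Q) ((piMod R n).smul a x) =
      (piMod S n).smul (AnAlg.app (f.app (op ⦋0⦌)) P a) (piMap f n Q x) := by
  induction x using PiObj.ind with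
  | h x =>
    refine congrArg PiObj.mk (Subtype.ext ?_)
    refine (AnAlg.app_mul _ _ _).trans ?_
    refine congrArg (fun k => (S _⦋n⦌).mul k _) ?_
    exact congrArg (fun k => AnAlg.app k P a) (f.naturality (SimplexCategory.const ⦋n⦌ ⦋0⦌ 0).op)

theorem piMap_map {R S : SAlg H} (f : R ⟶ S) (n : ℕ) {P Q : Fr H} (k : P ⟶ Q)
    (x : PiObj R n Q) :
    piMap f n P ((piMod R n).map k x) = (piMod S n).map k (piMap f n Q x) := by
  induction x using PiObj.ind with
  | h x => exact congrArg PiObj.mk (Subtype.ext (AnAlg.app_map _ k x.1))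

theorem piMap_comp {R S T : SAlg H} (f : R ⟶ S) (g : S ⟶ T) (n : ℕ) (P : Fr H)
    (x : PiObj R n P) : piMap (f ≫ g) n P x = piMap g n P (piMap f n P x) := by
  induction x using PiObj.ind with
  | h x => rfl

/-- Precomposition with `π_n(R) → π_n(S)`. -/
def LinOver.precomp {R S : SAlg H} (f : R ⟶ S) {n : ℕ} {D : AnAlg H} {N : ModOver D}
    {ρ : S _⦋0⦌ ⟶ D} {τ : R _⦋0⦌ ⟶ D} (h : f.app (op ⦋0⦌) ≫ ρ = τ)
    (φ : LinOver ρ (piMod S n) N) : LinOver τ (piMod R n) N where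
  app P := (φ.app P).comp (piMap f n P)
  naturality k x := (congrArg (φ.app _) (piMap_map f n k x)).trans (φ.naturality k _)
  map_smul a x := by
    subst h
    exact (congrArg (φ.app _) (piMap_smul f n a x)).trans (φ.map_smul _ _)

/-- A linear map from `π_n(A)` to a `π_0(C)`-module is extended to `π_n(B)` after restricting the
module to `π_0(B)`, and then to `π_n(C)`. -/
theorem IsStrongAt.comp {A B C : SAlg H} {f : A ⟶ B} {g : B ⟶ C} {n : ℕ}
    (hf : IsStrongAt f n) (hg : IsStrongAt g n) : IsStrongAt (f ≫ g) n := by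
  intro M φ
  have h1 : ((pi0Ideal A).proj ≫ pi0Map f) ≫ pi0Map g = (pi0Ideal A).proj ≫ pi0Map (f ≫ g) := rfl
  obtain ⟨ψ, hψ, hψ'⟩ := hf (M.restrict (pi0Map g)) (φ.toRestrict h1)
  obtain ⟨χ, hχ, hχ'⟩ := hg M (ψ.ofRestrict rfl)
  refine ⟨χ, fun P x => ?_, fun χ₂ h₂ => hχ' χ₂ fun P x => ?_⟩
  · rw [piMap_comp, hχ]
    exact hψ P x
  -- A competing extension restricts along `g` to an extension over `π_n(B)`, which must be `ψ`;
  -- uniqueness for `g` then applies.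
  · let ψ₂ : LinOver ((pi0Ideal B).proj ≫ pi0Map g) (piMod B n) M :=
      χ₂.precomp g (proj_pi0Map g).symm
    have h3 : ψ₂.toRestrict rfl = ψ := hψ' _ fun P x => by
      have := h₂ P x
      rw [piMap_comp] at this
      exact this
    rw [← h3]
    rfl

end Strong

/-! ### Tate algebras in `d + e` variables. -/

section Tate

variable {H : Type u} [NormedCommRing H]

/-- Splitting the exponents of monomials in `d + e` variables. -/
def splitExp (d e : ℕ) : (Fin (d + e) →₀ ℕ) ≃+ (Fin d →₀ ℕ) × (Fin e →₀ ℕ) :=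
  (Finsupp.domCongr finSumFinEquiv.symm).trans Finsupp.sumFinsuppAddEquivProdFinsupp

/-- Splitting the exponents, as a bijection of the index sets of free modules. -/
def splitIndex (d e : ℕ) :
    (tate (d + e) : Fr H).carrier ≃ ((tate d : Fr H).tensor (tate e)).carrier where
  toFun ν := (⟨(splitExp d e ν.down).1⟩, ⟨(splitExp d e ν.down).2⟩)
  invFun ν := ⟨(splitExp d e).symm (ν.1.down, ν.2.down)⟩
  left_inv ν := ULift.ext _ _ ((splitExp d e).symm_apply_apply ν.down)
  right_inv ν := by
    have h := (splitExp d e).apply_symm_apply (ν.1.down, ν.2.down)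
    exact Prod.ext (ULift.ext _ _ (congrArg Prod.fst h)) (ULift.ext _ _ (congrArg Prod.snd h))

/-- The isomorphism `H⟨X₁, …, X_{d + e}⟩ → H⟨X₁, …, X_d⟩ ⊗ H⟨Y₁, …, Y_e⟩` of modules. -/
def tateSplit (d e : ℕ) : (tate (d + e) : Fr H) ⟶ (tate d).tensor (tate e) :=
  reindex (splitIndex d e) fun _ => mul_one _

/-- The inverse of `tateSplit`. -/
def tateJoin (d e : ℕ) : (tate d : Fr H).tensor (tate e) ⟶ tate (d + e) :=
  reindex (splitIndex d e).symm fun _ => (mul_one _).symm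

theorem tateJoin_split (d e : ℕ) : tateJoin d e ≫ tateSplit d e = 𝟙 ((tate d : Fr H).tensor _) :=
  hom_ext fun x s => congrArg x.1 ((splitIndex d e).apply_symm_apply s)

/-- The inverse of the associativity isomorphism. -/
def assocInv (P Q R : Fr H) : P.tensor (Q.tensor R) ⟶ (P.tensor Q).tensor R :=
  reindex (Equiv.prodAssoc P.carrier Q.carrier R.carrier).symm fun _ => mul_assoc _ _ _

theorem AnAlg.mul_assoc_inv (A : AnAlg H) {P Q R : Fr H} (a : A.obj P) (b : A.obj Q)
    (c : A.obj R) : A.mul a (A.mul b c) = A.map (assocInv P Q R) (A.mul (A.mul a b) c) := by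
  rw [A.mul_assoc, ← A.map_comp]
  exact (A.map_id _).symm

/-- The exchange isomorphism `(P ⊗ Q) ⊗ (P ⊗ Q) → (P ⊗ P) ⊗ (Q ⊗ Q)`. -/
def exchange (P Q : Fr H) :
    (P.tensor Q).tensor (P.tensor Q) ⟶ (P.tensor P).tensor (Q.tensor Q) :=
  reindex (Equiv.prodProdProdComm P.carrier Q.carrier P.carrier Q.carrier)
    fun _ => mul_mul_mul_comm _ _ _ _

theorem AnAlg.mul_mul_mul_comm (A : AnAlg H) {P Q : Fr H} (a : A.obj P) (b : A.obj Q) :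
    A.mul (A.mul a b) (A.mul a b) = A.map (exchange P Q) (A.mul (A.mul a a) (A.mul b b)) := by
  rw [A.mul_assoc, A.mul_assoc_inv b a b, A.mul_comm b a, A.mul_map, A.mul_assoc a b b,
    A.mul_map_right, A.mul_map_right, A.mul_map_right, A.mul_assoc_inv a a]
  simp only [← A.map_comp]
  rfl

theorem AnAlg.mul_map_map (A : AnAlg H) {P P' Q Q' : Fr H} (f : P ⟶ P') (g : Q ⟶ Q')
    (a : A.obj P') (b : A.obj Q') :
    A.mul (A.map f a) (A.map g b) = A.map (rTensor f Q ≫ lTensor P' g) (A.mul a b) := by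
  rw [A.mul_map, A.mul_map_right, A.map_comp]

theorem tateOne_split (d e : ℕ) : tateOne (d + e) ≫ tateSplit d e =
    dup ≫ rTensor (tateOne d) Fr.pt ≫ lTensor (tate d : Fr H) (tateOne e) := by
  refine hom_ext fun x s => ?_
  change (if (splitExp d e).symm (s.1.down, s.2.down) = 0 then x.1 PUnit.unit else 0) =
    if s.2.down = 0 then (if s.1.down = 0 then x.1 PUnit.unit else 0) else 0
  have h : (splitExp d e).symm (s.1.down, s.2.down) = 0 ↔ s.1.down = 0 ∧ s.2.down = 0 := by
    rw [EmbeddingLike.map_eq_zero_iff, Prod.mk_eq_zero]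
  simp only [h]
  by_cases h1 : s.1.down = 0 <;> by_cases h2 : s.2.down = 0 <;> simp [h1, h2]

/-- Splitting exponents is additive, so the decompositions of an exponent as a sum are pairs of
decompositions of its two blocks; the multiplication is thus the tensor product of the two
multiplications. -/
theorem tateMul_split [IsUltrametricDist H] (d e : ℕ) : tateMul (d + e) ≫ tateSplit d e =
    (rTensor (tateSplit d e) (tate (d + e)) ≫ lTensor _ (tateSplit d e)) ≫ exchange _ _ ≫
      rTensor (tateMul d) _ ≫ lTensor (tate d : Fr H) (tateMul e) := by
  refine hom_ext fun x s => ?_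
  change ∑ p ∈ Finset.HasAntidiagonal.antidiagonal ((splitExp d e).symm (s.1.down, s.2.down)),
      x.1 (⟨p.1⟩, ⟨p.2⟩) =
    ∑ q ∈ Finset.HasAntidiagonal.antidiagonal s.2.down,
      ∑ p ∈ Finset.HasAntidiagonal.antidiagonal s.1.down,
        x.1 (⟨(splitExp d e).symm (p.1, q.1)⟩, ⟨(splitExp d e).symm (p.2, q.2)⟩)
  rw [← Finset.sum_product']
  -- The outer sum on the right comes from the last `e` variables, so that block is listed first in
  -- the target pairs.
  refine Finset.sum_nbij'
    (fun p => (((splitExp d e p.1).2, (splitExp d e p.2).2),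
      ((splitExp d e p.1).1, (splitExp d e p.2).1)))
    (fun r => ((splitExp d e).symm (r.2.1, r.1.1), (splitExp d e).symm (r.2.2, r.1.2)))
    ?_ ?_ ?_ ?_ ?_
  · intro p hp
    rw [Finset.HasAntidiagonal.mem_antidiagonal, AddEquiv.eq_symm_apply, map_add] at hp
    exact Finset.mem_product.2
      ⟨Finset.HasAntidiagonal.mem_antidiagonal.2 (congrArg Prod.snd hp),
        Finset.HasAntidiagonal.mem_antidiagonal.2 (congrArg Prod.fst hp)⟩
  · intro r hr
    obtain ⟨hr1, hr2⟩ := Finset.mem_product.1 hr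
    replace hr1 := Finset.HasAntidiagonal.mem_antidiagonal.1 hr1
    replace hr2 := Finset.HasAntidiagonal.mem_antidiagonal.1 hr2
    rw [Finset.HasAntidiagonal.mem_antidiagonal, ← map_add]
    exact congrArg _ (Prod.ext hr2 hr1)
  · intro p _
    simp
  · intro r _
    simp
  · intro p _
    simp

theorem IsTateQuotient.comp [IsUltrametricDist H] {A B C : AnAlg H} {φ : A ⟶ B} {ψ : B ⟶ C}
    (hφ : IsTateQuotient φ) (hψ : IsTateQuotient ψ) : IsTateQuotient (φ ≫ ψ) := by
  obtain ⟨d, μ, hμ1, hμ2, hμ3⟩ := hφ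
  obtain ⟨e, ν, hν1, hν2, hν3⟩ := hψ
  have h1 : C.map (tateOne d) (AnAlg.app ψ _ μ) = C.one := by
    rw [← AnAlg.app_map, hμ1]
    exact AnAlg.Hom.map_one ψ
  have h2 : C.map (tateMul d) (AnAlg.app ψ _ μ) =
      C.mul (AnAlg.app ψ _ μ) (AnAlg.app ψ _ μ) := by
    rw [← AnAlg.app_map, hμ2, AnAlg.app_mul]
  -- The monomial in both sets of variables goes to the product of the image of the first block
  -- under `ψ` with the image of the second.
  refine ⟨d + e, C.map (tateSplit d e) (C.mul (AnAlg.app ψ _ μ) ν), ?_, ?_, fun P c => ?_⟩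
  · rw [← C.map_comp, tateOne_split, C.map_comp, ← C.mul_map_map, h1, hν1]
    exact C.one_ptMul C.one
  · rw [← C.map_comp, tateMul_split, C.map_comp, C.map_comp (exchange _ _), ← C.mul_map_map, h2,
      hν2, ← C.mul_mul_mul_comm, C.mul_map_map]
  · obtain ⟨Q, b, m, rfl⟩ := hν3 P c
    obtain ⟨Q', a, m', rfl⟩ := hμ3 Q b
    -- The presentation of `b` is substituted into that of `c`, and the two blocks of variables are
    -- merged into one.
    refine ⟨Q', a, m ≫ rTensor m' (tate e) ≫ assoc _ _ _ ≫ lTensor Q' (tateJoin d e), ?_⟩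
    rw [C.map_comp, C.map_comp, C.map_comp, ← C.mul_map_right, ← C.map_comp (tateJoin d e),
      tateJoin_split, C.map_id, ← C.mul_assoc, ← C.mul_map, AnAlg.app_map, AnAlg.app_mul,
      AnAlg.app_comp]

end Tate

/-! ### Assembly of the two clauses. -/

section Composition

variable {H : Type u} [NormedCommRing H] [IsUltrametricDist H] {A B C : SAlg H} {f : A ⟶ B}
  {g : B ⟶ C}

theorem IsAffinoid.comp (hf : IsAffinoid f) (hg : IsAffinoid g) : IsAffinoid (f ≫ g) where
  tate := by
    rw [pi0Map_comp]
    exact hf.tate.comp hg.tate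
  strong n := (hf.strong n).comp (hg.strong n)

theorem IsPDIntrinsicEtale.comp (hf : IsPDIntrinsicEtale f) (hg : IsPDIntrinsicEtale g) :
    IsPDIntrinsicEtale (f ≫ g) where
  affinoid := hf.affinoid.comp hg.affinoid
  bijective R := toCrys_bijective fun I => fpPoint_comp_bijective
    (fpPoint_bijective hf.bijective R I) (fpPoint_bijective hg.bijective R I)

end Composition

end AnGeom

end

theorem mainTheorem10 (H : Type u) [NormedCommRing H] [IsUltrametricDist H] [CompleteSpace H]
    {A B C : AnGeom.SAlg H} (f : A ⟶ B) (g : B ⟶ C)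
    (hf : AnGeom.IsPDIntrinsicEtale f) (hg : AnGeom.IsPDIntrinsicEtale g) :
    AnGeom.IsPDIntrinsicEtale (f ≫ g) :=
  hf.comp hg
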